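/- **Proposition 4.2.** For an $n$-tuple $T=(T_1,\dots,T_n)$ of commuting bounded operators on a complex Banach space $X$ put $\hat T:X^n\to X$, $\hat T(x_1,\dots,x_n)=\sum_i T_ix_i$, and $\tilde T:X\to X^n$, $\tilde T(x)=(T_1x,\dots,T_nx)$; write $R(\cdot)$ and $N(\cdot)$ for range and null space, $M_1(T)=R(T_1)+\dots+R(T_n)$, and $T-\lambda=(T_1-\lambda_1I,\dots,T_n-\lambda_nI)$ for $\lambda\in\mathbb C^n$. Define the following subsets of $\mathbb C^n$: - $\sigma_{\Phi_-}(T)=\{\lambda:\operatorname{codim}M_1(T-\lambda)=\infty\}$ and $\sigma_\delta(T)=\{\lambda:M_1(T-\lambda)\neq X\}$; - $\sigma_{\Phi_+}(T)=\{\lambda: \dim N(\widetilde{T-\lambda})=\infty$ or $R(\widetilde{T-\lambda})$ is not closed$\}$ and $\sigma_\pi(T)=\{\lambda: N(\widetilde{T-\lambda})\neq0$ or $R(\widetilde{T-\lambda})$ is not closed$\}$; - $\mathcal C_-(T)=\{\lambda: N(\widehat{T-\lambda})$ has no topological direct complement in $X^n\}$ and $\mathcal C_+(T)=\{\lambda: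 R(\widetilde{T-\lambda})$ has no topological direct complement in $X^n\}$; - $sp_\delta(T)=\sigma_\delta(T)\cup\mathcal C_-(T)$, $\;sp_{\delta e}(T)=\sigma_{\Phi_-}(T)\cup\mathcal C_-(T)$, $\;sp_\pi(T)=\sigma_\pi(T)\cup\mathcal C_+(T)$, $\;sp_{\pi e}(T)=\sigma_{\Phi_+}(T)\cup\mathcal C_+(T)$. Let $X_1$, $X_2$ be complex Banach spaces with duals $X_1'$, $X_2'$. Let $X_1\tilde\otimes X_2$ be a tensor product of $X_1$ and $X_2$ relative to $\langle X_1,X_1'\rangle$ and $\langle X_2,X_2'\rangle$ in the sense of Eschmeier, that is, a complex Banach space together with continuous bilinear maps $X_1\times X_2\to X_1\tilde\otimes X_2$, $(x,y)\mapsto x\otimes y$, and $L(X_1)\times L(X_2)\to L(X_1\tilde\otimes X_2)$, $(A,B)\mapsto A\otimes B$, such that 1. $\|x\otimes y\|=\|x\|\,\|y\|$; 2. $(A\otimes B)(x\otimes y)=Ax\otimes By$; 3. $(A_1\otimes B_1)(A_2\otimes B_2)=A_1A_2\otimes B_1B_2$ and $I\otimes I=I$; 4. $R(f_{x,u}\otimes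 I)\subseteq\{x\otimes y:y\in X_2\}$ and $R(I\otimes f_{y,v})\subseteq\{x\otimes y:x\in X_1\}$ for all $x\in X_1$, $u\in X_1'$, $y\in X_2$, $v\in X_2'$, where $f_{x,u}(z)=u(z)x$ and $f_{y,v}(z)=v(z)y$. Let $S=(S_1,\dots,S_n)$ and $T=(T_1,\dots,T_m)$ be tuples of commuting bounded operators on $X_1$ and $X_2$ respectively, and let $(S\otimes I,I\otimes T)=(S_1\otimes I,\dots,S_n\otimes I,I\otimes T_1,\dots,I\otimes T_m)$ on $X_1\tilde\otimes X_2$. Then, identifying $\mathbb C^n\times\mathbb C^m$ with $\mathbb C^{n+m}$, (i) $\sigma_{\Phi_-}(S)\times\sigma_\delta(T)\,\cup\,\sigma_\delta(S)\times\sigma_{\Phi_-}(T)\subseteq\sigma_{\Phi_-}(S\otimes I,I\otimes T)\subseteq sp_{\delta e}(S\otimes I,I\otimes T)\subseteq sp_{\delta e}(S)\times sp_\delta(T)\,\cup\,sp_\delta(S)\times sp_{\delta e}(T)$; (ii) $\sigma_{\Phi_+}(S)\times\sigma_\pi(T)\,\cup\,\sigma_\pi(S)\times\sigma_{\Phi_+}(T)\subseteq\sigma_{\Phi_+}(S\otimes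 I,I\otimes T)\subseteq sp_{\pi e}(S\otimes I,I\otimes T)\subseteq sp_{\pi e}(S)\times sp_\pi(T)\,\cup\,sp_\pi(S)\times sp_{\pi e}(T)$. If, in addition, $X_1$ and $X_2$ are Hilbert spaces, then all the inclusions in (i) and (ii) are equalities. -/

import Mathlib

namespace JointSpectra

section Tuples

variable {X : Type*} [NormedAddCommGroup X] [NormedSpace ℂ X] {n : ℕ}

/-- The tuple `T - lam = (T₁ - lam₁ I, …, Tₙ - lamₙ I)`. -/
def shift (T : Fin n → (X →L[ℂ] X)) (lam : Fin n → ℂ) : Fin n → (X →L[ℂ] X) :=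
  fun i => T i - lam i • ContinuousLinearMap.id ℂ X

/-- `M₁(T) = R(T₁) + … + R(Tₙ)`. -/
def rangeSum (T : Fin n → (X →L[ℂ] X)) : Submodule ℂ X :=
  ⨆ i, LinearMap.range (T i : X →ₗ[ℂ] X)

/-- `T̂ : Xⁿ → X`, `T̂ (x₁, …, xₙ) = T₁ x₁ + … + Tₙ xₙ`. -/
noncomputable def rowMap (T : Fin n → (X →L[ℂ] X)) : (Fin n → X) →L[ℂ] X :=
  ∑ i, (T i).comp (ContinuousLinearMap.proj i)

/-- `T̃ : X → Xⁿ`, `T̃ x = (T₁ x, …, Tₙ x)`. -/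
def colMap (T : Fin n → (X →L[ℂ] X)) : X →L[ℂ] (Fin n → X) :=
  ContinuousLinearMap.pi T

/-- `T` is lower semi-Fredholm: `codim M₁(T) < ∞`. -/
def IsLowerSemiFredholm (T : Fin n → (X →L[ℂ] X)) : Prop :=
  FiniteDimensional ℂ (X ⧸ rangeSum T)

/-- `T` is upper semi-Fredholm: `T̃` has finite-dimensional null space and closed range. -/
def IsUpperSemiFredholm (T : Fin n → (X →L[ℂ] X)) : Prop :=
  FiniteDimensional ℂ (LinearMap.ker (colMap T : X →ₗ[ℂ] (Fin n → X))) ∧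
    IsClosed (Set.range (colMap T))

/-- The lower semi-Fredholm spectrum `σ_{Φ₋}(T)`. -/
def sigmaPhiMinus (T : Fin n → (X →L[ℂ] X)) : Set (Fin n → ℂ) :=
  {lam | ¬ IsLowerSemiFredholm (shift T lam)}

/-- The upper semi-Fredholm spectrum `σ_{Φ₊}(T)`. -/
def sigmaPhiPlus (T : Fin n → (X →L[ℂ] X)) : Set (Fin n → ℂ) :=
  {lam | ¬ IsUpperSemiFredholm (shift T lam)}

/-- The defect spectrum `σ_δ(T)`: `M₁(T - lam)` has nonzero (possibly infinite) codimension. -/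
def sigmaDelta (T : Fin n → (X →L[ℂ] X)) : Set (Fin n → ℂ) :=
  {lam | rangeSum (shift T lam) ≠ ⊤}

/-- The approximate point spectrum `σ_π(T)`. -/
def sigmaPi (T : Fin n → (X →L[ℂ] X)) : Set (Fin n → ℂ) :=
  {lam | LinearMap.ker (colMap (shift T lam) : X →ₗ[ℂ] (Fin n → X)) ≠ ⊥ ∨
    ¬ IsClosed (Set.range (colMap (shift T lam)))}

/-- `𝒞₋(T)`: the null space of the row operator of `T - lam` has no direct (topological)
complement in `Xⁿ`, i.e. it is not the range of a bounded projection. -/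
def CMinus (T : Fin n → (X →L[ℂ] X)) : Set (Fin n → ℂ) :=
  {lam | ¬ (LinearMap.ker (rowMap (shift T lam) : (Fin n → X) →ₗ[ℂ] X)).ClosedComplemented}

/-- `𝒞₊(T)`: the range of the column operator of `T - lam` has no direct (topological)
complement in `Xⁿ`. -/
def CPlus (T : Fin n → (X →L[ℂ] X)) : Set (Fin n → ℂ) :=
  {lam | ¬ (LinearMap.range (colMap (shift T lam) : X →ₗ[ℂ] (Fin n → X))).ClosedComplemented}

/-- The split defect spectrum `sp_δ(T)`. -/
def spDelta (T : Fin n → (X →L[ℂ] X)) : Set (Fin n → ℂ) :=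
  sigmaDelta T ∪ CMinus T

/-- The essential split defect spectrum `sp_{δe}(T)`. -/
def spDeltaE (T : Fin n → (X →L[ℂ] X)) : Set (Fin n → ℂ) :=
  sigmaPhiMinus T ∪ CMinus T

/-- The split approximate point spectrum `sp_π(T)`. -/
def spPi (T : Fin n → (X →L[ℂ] X)) : Set (Fin n → ℂ) :=
  sigmaPi T ∪ CPlus T

/-- The essential split approximate point spectrum `sp_{πe}(T)`. -/
def spPiE (T : Fin n → (X →L[ℂ] X)) : Set (Fin n → ℂ) :=
  sigmaPhiPlus T ∪ CPlus T

end Tuples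

/-- The product `A × B ⊆ ℂⁿ × ℂᵐ`, seen in `ℂⁿ⁺ᵐ` by concatenating coordinates. -/
def prodSet {n m : ℕ} (A : Set (Fin n → ℂ)) (B : Set (Fin m → ℂ)) : Set (Fin (n + m) → ℂ) :=
  Set.image2 Fin.append A B

/-- A tensor product (in the axiomatic sense of Eschmeier) of the Banach spaces `X` and `Y`
relative to the dual pairings `⟨X, X'⟩` and `⟨Y, Y'⟩`, realised on the Banach space `Z`.
For these pairings the algebras `ℒ(X)` and `ℒ(Y)` consist of all bounded operators. The rank-one
operator `f_{x,u} : z ↦ ⟨z, u⟩ x` is `u.smulRight x`. -/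
structure BanachTensor (X Y Z : Type*)
    [NormedAddCommGroup X] [NormedSpace ℂ X] [NormedAddCommGroup Y] [NormedSpace ℂ Y]
    [NormedAddCommGroup Z] [NormedSpace ℂ Z] where
  /-- the continuous bilinear map `(x, y) ↦ x ⊗ y` -/
  vec : X →L[ℂ] Y →L[ℂ] Z
  /-- the continuous bilinear map `(A, B) ↦ A ⊗ B` on operators -/
  op : (X →L[ℂ] X) →L[ℂ] (Y →L[ℂ] Y) →L[ℂ] (Z →L[ℂ] Z)
  norm_vec : ∀ x y, ‖vec x y‖ = ‖x‖ * ‖y‖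
  op_vec : ∀ A B x y, op A B (vec x y) = vec (A x) (B y)
  op_comp : ∀ A₁ B₁ A₂ B₂, (op A₁ B₁).comp (op A₂ B₂) = op (A₁.comp A₂) (B₁.comp B₂)
  op_id : op (ContinuousLinearMap.id ℂ X) (ContinuousLinearMap.id ℂ Y) =
    ContinuousLinearMap.id ℂ Z
  range_left : ∀ (x : X) (u : X →L[ℂ] ℂ),
    Set.range (op (u.smulRight x) (ContinuousLinearMap.id ℂ Y)) ⊆ {z | ∃ y : Y, z = vec x y}
  range_right : ∀ (y : Y) (v : Y →L[ℂ] ℂ),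
    Set.range (op (ContinuousLinearMap.id ℂ X) (v.smulRight y)) ⊆ {z | ∃ x : X, z = vec x y}

/-- The `(n + m)`-tuple `(S ⊗ I, I ⊗ T) = (S₁ ⊗ I, …, Sₙ ⊗ I, I ⊗ T₁, …, I ⊗ Tₘ)`. -/
noncomputable def BanachTensor.tuple {X Y Z : Type*}
    [NormedAddCommGroup X] [NormedSpace ℂ X] [NormedAddCommGroup Y] [NormedSpace ℂ Y]
    [NormedAddCommGroup Z] [NormedSpace ℂ Z] (P : BanachTensor X Y Z) {n m : ℕ}
    (S : Fin n → (X →L[ℂ] X)) (T : Fin m → (Y →L[ℂ] Y)) : Fin (n + m) → (Z →L[ℂ] Z) :=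
  Fin.append (fun i => P.op (S i) (ContinuousLinearMap.id ℂ Y))
    (fun j => P.op (ContinuousLinearMap.id ℂ X) (T j))

/-- The norm of `X` comes from an inner product (a complete such space is a Hilbert space). -/
def IsInnerProductNorm (X : Type*) [NormedAddCommGroup X] [h : NormedSpace ℂ X] : Prop :=
  ∃ inst : InnerProductSpace ℂ X, inst.toNormedSpace = h

end JointSpectra

open JointSpectra

/-!
The first inclusions rest on the slice maps `φ_v : Z → X₁`, `x ⊗ y ↦ v(y) x`, for `v ∈ X₂'`
(`BanachTensor.exists_slice`). They intertwine `A ⊗ I` with `A`, satisfy `φ_v ∘ (I ⊗ B) = φ_{vB}`,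
and `‖φ_v‖` is bounded by a multiple of `‖v‖`. By translation only the point `0` matters.

For the lower semi-Fredholm spectrum, suppose `M₁(T) ≠ X₂`. If `M₁(T)` is not dense, slicing by a
functional that annihilates it maps `M₁(S ⊗ I, I ⊗ T)` into `M₁(S)`, so finite codimension passes
to `S`. If `M₁(T)` is dense, while `M₁(S) ≠ X₁`, finite codimension of `M₁(S ⊗ I, I ⊗ T)` would make
it closed, hence contain every `x ⊗ y`, with controlled preimages under the row map; testing these
against `u ⊗ v`, where `u`, `v` are approximate joint null functionals of `S`, `T`, is absurd
(`BanachTensor.not_isLowerSemiFredholm_of_dense`). The upper semi-Fredholm case is dual: an exact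
joint null vector `y` of `T` embeds the column map of `S` into that of the tensor tuple by
`x ↦ x ⊗ y`, and when there are only approximate ones on both sides the tensor column map cannot
have closed range (`BanachTensor.not_isClosed_range_colMap_tuple`).

For the last inclusions, lying outside `sp_δ`, `sp_{δe}`, `sp_π`, `sp_{πe}` means that the row map
has a right inverse, respectively the column map a left inverse, exactly or modulo finite rank
operators (`notMem_spDelta_iff` and its three analogues). One-sided inverses for `S` or for `T` give
one for the tensor tuple, and the identity `I - F ⊗ G = (I - F) ⊗ I + F ⊗ (I - G)` does the same for
inverses modulo finite rank operators `F` and `G`.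

In Hilbert spaces closed subspaces of `Xⁿ` are complemented, so that the split spectra of `S` and
`T` agree with the non-split ones and both chains of inclusions close up.
-/

open JointSpectra

namespace JointSpectra

/-! ### Operators between Banach spaces -/

section Operators

variable {E F : Type*} [NormedAddCommGroup E] [NormedSpace ℂ E] [NormedAddCommGroup F]
  [NormedSpace ℂ F]

/-- An operator with complemented kernel and finite-codimensional range has a right inverse modulo
an operator with values in a prescribed complement `G` of the range. -/
theorem exists_rightInverse_sub [CompleteSpace E] [CompleteSpace F] (R : E →L[ℂ] F)
    (hker : (LinearMap.ker (R : E →ₗ[ℂ] F)).ClosedComplemented) (G : Submodule ℂ F)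
    [FiniteDimensional ℂ G] (hG : IsCompl (LinearMap.range (R : E →ₗ[ℂ] F)) G) :
    ∃ (W : F →L[ℂ] E) (K : F →L[ℂ] F), (∀ y, K y ∈ G) ∧ ∀ y, R (W y) = y - K y := by
  obtain ⟨N, hN⟩ := hker.exists_isTopCompl
  have : CompleteSpace N := hN.symm.isClosed.completeSpace_coe
  let f : (N × G) →L[ℂ] F := (R.comp N.subtypeL).coprod G.subtypeL
  have hinj : LinearMap.ker (f : (N × G) →ₗ[ℂ] F) = ⊥ := by
    rw [LinearMap.ker_eq_bot']
    rintro ⟨a, g⟩ h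
    have h : R a + g = 0 := h
    have h1 : R a = -g := eq_neg_of_add_eq_zero_left h
    have h2 : R a = 0 := by
      have := hG.disjoint.le_bot
        ⟨LinearMap.mem_range_self (R : E →ₗ[ℂ] F) (a : E), by
          show R a ∈ G
          rw [h1]; exact G.neg_mem g.2⟩
      simpa using this
    have h3 : (a : E) = 0 := by
      have := hN.isCompl.disjoint.le_bot
        ⟨(show (a : E) ∈ LinearMap.ker (R : E →ₗ[ℂ] F) from h2), a.2⟩
      simpa using this
    have h4 : (g : F) = 0 := by simpa [h2] using h
    ext <;> simp [h3, h4]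
  have hsurj : LinearMap.range (f : (N × G) →ₗ[ℂ] F) = ⊤ := by
    rw [LinearMap.range_eq_top]
    intro y
    obtain ⟨_, ⟨x, rfl⟩, g, hg, rfl⟩ :=
      Submodule.mem_sup.1 (hG.sup_eq_top ▸ Submodule.mem_top (x := y))
    obtain ⟨k, hk, a, ha, rfl⟩ :=
      Submodule.mem_sup.1 (hN.isCompl.sup_eq_top ▸ Submodule.mem_top (x := x))
    refine ⟨(⟨a, ha⟩, ⟨g, hg⟩), ?_⟩
    have : R k = 0 := hk
    simp [f, this]
  let e := ContinuousLinearEquiv.ofBijective f hinj hsurj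
  refine ⟨N.subtypeL.comp ((ContinuousLinearMap.fst ℂ N G).comp (e.symm : F →L[ℂ] (N × G))),
    G.subtypeL.comp ((ContinuousLinearMap.snd ℂ N G).comp (e.symm : F →L[ℂ] (N × G))),
    fun y => (e.symm y).2.2, fun y => ?_⟩
  have h : f (e.symm y) = y := e.apply_symm_apply y
  have h : R (e.symm y).1 + (e.symm y).2 = y := h
  exact eq_sub_of_add_eq h

theorem finiteDimensional_quotient_range_of_comp_eq_sub (R : E →L[ℂ] F) (W : F →L[ℂ] E)
    (K : F →L[ℂ] F) [FiniteDimensional ℂ (LinearMap.range (K : F →ₗ[ℂ] F))]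
    (h : ∀ y, R (W y) = y - K y) :
    FiniteDimensional ℂ (F ⧸ LinearMap.range (R : E →ₗ[ℂ] F)) := by
  let q := (LinearMap.range (R : E →ₗ[ℂ] F)).mkQ ∘ₗ (LinearMap.range (K : F →ₗ[ℂ] F)).subtype
  refine FiniteDimensional.of_surjective q fun z => ?_
  obtain ⟨y, rfl⟩ := Submodule.mkQ_surjective _ z
  refine ⟨⟨K y, y, rfl⟩, ?_⟩
  refine ((Submodule.Quotient.eq _).2 ⟨-W y, ?_⟩)
  simp [h]

theorem closedComplemented_ker_of_comp_eq_sub [CompleteSpace E] (R : E →L[ℂ] F)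
    (W : F →L[ℂ] E) (K : F →L[ℂ] F) [FiniteDimensional ℂ (LinearMap.range (K : F →ₗ[ℂ] F))]
    (h : ∀ y, R (W y) = y - K y) :
    (LinearMap.ker (R : E →ₗ[ℂ] F)).ClosedComplemented := by
  have : FiniteDimensional ℂ (LinearMap.range (K.comp R : E →ₗ[ℂ] F)) :=
    Submodule.finiteDimensional_of_le (S₂ := LinearMap.range (K : F →ₗ[ℂ] F)) <| by
      rintro _ ⟨x, rfl⟩
      exact ⟨R x, rfl⟩
  obtain ⟨p, hp⟩ := (K.comp R).ker_closedComplemented_of_finiteDimensional_range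
  -- `x - W R x` maps the kernel of `K R` into the kernel of `R`, and fixes the latter.
  let Q : E →L[ℂ] E := ContinuousLinearMap.id ℂ E - W.comp R
  refine ⟨(Q.comp ((Submodule.subtypeL _).comp p)).codRestrict _ fun x => ?_, fun x => ?_⟩
  · have hp0 : K (R (p x)) = 0 := (p x).2
    change R ((p x : E) - W (R (p x))) = 0
    rw [map_sub, h, hp0, sub_zero, sub_self]
  · have hx : R x = 0 := x.2
    have hpx : (p (x : E) : E) = x := congrArg Subtype.val (hp ⟨x, by simp [hx]⟩)
    ext
    change (p (x : E) : E) - W (R (p (x : E))) = x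
    rw [hpx, hx, map_zero, sub_zero]

/-- An operator with finite-dimensional kernel and complemented range has a left inverse modulo
an operator with values in its kernel. -/
theorem exists_leftInverse_sub [CompleteSpace E] [CompleteSpace F] (C : E →L[ℂ] F)
    [FiniteDimensional ℂ (LinearMap.ker (C : E →ₗ[ℂ] F))]
    (hC : (LinearMap.range (C : E →ₗ[ℂ] F)).ClosedComplemented) :
    ∃ (W : F →L[ℂ] E) (K : E →L[ℂ] E), (∀ x, K x ∈ LinearMap.ker (C : E →ₗ[ℂ] F)) ∧
      ∀ x, W (C x) = x - K x := by
  obtain ⟨N, hN⟩ :=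
    (Submodule.ClosedComplemented.of_finiteDimensional
      (LinearMap.ker (C : E →ₗ[ℂ] F))).exists_isTopCompl
  have : CompleteSpace N := hN.symm.isClosed.completeSpace_coe
  let f : N →L[ℂ] F := C.comp N.subtypeL
  have hr : LinearMap.range (f : N →ₗ[ℂ] F) = LinearMap.range (C : E →ₗ[ℂ] F) := by
    apply le_antisymm
    · rintro _ ⟨x, rfl⟩
      exact ⟨x, rfl⟩
    · rintro _ ⟨x, rfl⟩
      obtain ⟨k, hk, a, ha, rfl⟩ :=
        Submodule.mem_sup.1 (hN.isCompl.sup_eq_top ▸ Submodule.mem_top (x := x))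
      have : C k = 0 := hk
      exact ⟨⟨a, ha⟩, by simp [f, this]⟩
  have hinj : Function.Injective f := by
    rw [injective_iff_map_eq_zero]
    intro a ha
    have := hN.isCompl.disjoint.le_bot
      ⟨(show (a : E) ∈ LinearMap.ker (C : E →ₗ[ℂ] F) from ha), a.2⟩
    simpa using this
  obtain ⟨g, hg⟩ := open ContinuousLinearMap.HasLeftInverse in
    of_injective_of_isClosed_range_of_closedComplement_range hinj
      (by have := hC.isClosed; rw [← hr] at this; exact this) (by rw [← hr] at hC; exact hC)
  refine ⟨N.subtypeL.comp g, ContinuousLinearMap.id ℂ E - N.subtypeL.comp (g.comp C),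
    fun x => ?_, fun x => by simp⟩
  obtain ⟨k, hk, a, ha, rfl⟩ :=
    Submodule.mem_sup.1 (hN.isCompl.sup_eq_top ▸ Submodule.mem_top (x := x))
  have hk : C k = 0 := hk
  have := hg ⟨a, ha⟩
  have : g (C a) = ⟨a, ha⟩ := this
  simp [hk, this]

theorem closedComplemented_sup_of_finiteDimensional {M G : Submodule ℂ E}
    (hM : M.ClosedComplemented) [FiniteDimensional ℂ G] : (M ⊔ G).ClosedComplemented := by
  obtain ⟨p, hp⟩ := hM
  let q : E →L[ℂ] E := ContinuousLinearMap.id ℂ E - M.subtypeL.comp p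
  obtain ⟨r, hr⟩ := Submodule.ClosedComplemented.of_finiteDimensional (G.map (q : E →ₗ[ℂ] E))
  have hGM : G.map (q : E →ₗ[ℂ] E) ≤ M ⊔ G := by
    rintro _ ⟨g, hg, rfl⟩
    exact (M ⊔ G).sub_mem (le_sup_right (a := M) hg) (le_sup_left (b := G) (p g).2)
  refine ⟨(M.subtypeL.comp p + (Submodule.subtypeL _).comp (r.comp q)).codRestrict _ fun x => ?_,
    fun x => ?_⟩
  · exact (M ⊔ G).add_mem (le_sup_left (b := G) (p x).2) (hGM (r (q x)).2)
  · obtain ⟨x, hx⟩ := x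
    obtain ⟨a, ha, g, hg, rfl⟩ := Submodule.mem_sup.1 hx
    have h1 : p a = ⟨a, ha⟩ := hp ⟨a, ha⟩
    have hqa : q a = 0 := by simp [q, h1]
    have h2 : r (q g) = ⟨q g, ⟨g, hg, rfl⟩⟩ := hr ⟨q g, ⟨g, hg, rfl⟩⟩
    ext
    simp [hqa, h1, h2]
    simp [q]

theorem finiteDimensional_ker_of_comp_eq_sub (C : E →L[ℂ] F) (W : F →L[ℂ] E)
    (K : E →L[ℂ] E) [FiniteDimensional ℂ (LinearMap.range (K : E →ₗ[ℂ] E))]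
    (h : ∀ x, W (C x) = x - K x) : FiniteDimensional ℂ (LinearMap.ker (C : E →ₗ[ℂ] F)) :=
  Submodule.finiteDimensional_of_le (S₂ := LinearMap.range (K : E →ₗ[ℂ] E)) fun x hx => by
    have hx : C x = 0 := hx
    exact ⟨x, (sub_eq_zero.1 (by rw [← map_zero W, ← hx, h]; rfl)).symm⟩

/-- On the kernel of `K`, which has finite codimension, `W` is a left inverse of `C`; so the image
of this kernel is complemented, and the range of `C` is its sum with a finite-dimensional space. -/
theorem closedComplemented_range_of_comp_eq_sub (C : E →L[ℂ] F) (W : F →L[ℂ] E)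
    (K : E →L[ℂ] E) [FiniteDimensional ℂ (LinearMap.range (K : E →ₗ[ℂ] E))]
    (h : ∀ x, W (C x) = x - K x) : (LinearMap.range (C : E →ₗ[ℂ] F)).ClosedComplemented := by
  obtain ⟨p, hp⟩ := K.ker_closedComplemented_of_finiteDimensional_range
  obtain ⟨G, hG⟩ := (LinearMap.ker (K : E →ₗ[ℂ] E)).exists_isCompl
  have : FiniteDimensional ℂ G :=
    ((Submodule.quotientEquivOfIsCompl _ _ hG).symm.trans
      (K : E →ₗ[ℂ] E).quotKerEquivRange).symm.finiteDimensional
  have hM : ((LinearMap.ker (K : E →ₗ[ℂ] E)).map (C : E →ₗ[ℂ] F)).ClosedComplemented := by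
    refine ⟨(C.comp ((Submodule.subtypeL _).comp (p.comp W))).codRestrict _
      fun x => ⟨_, (p (W x)).2, rfl⟩, ?_⟩
    rintro ⟨_, x, hx, rfl⟩
    have hx' : K x = 0 := hx
    have hpx : p x = ⟨x, hx⟩ := hp ⟨x, hx⟩
    ext
    change C (p (W (C x))) = C x
    rw [h, hx', sub_zero, hpx]
  have := closedComplemented_sup_of_finiteDimensional hM (G := G.map (C : E →ₗ[ℂ] F))
  rwa [← Submodule.map_sup, hG.sup_eq_top, Submodule.map_top] at this

/-- The quantitative form of closed range: `‖f x‖` dominates the distance from `x` to the kernel. -/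
theorem isClosed_range_iff_exists_norm_sub_le [CompleteSpace E] [CompleteSpace F]
    (f : E →L[ℂ] F) : IsClosed (Set.range f) ↔
      ∃ c : ℝ, ∀ x, ∃ w, f w = 0 ∧ ‖x - w‖ ≤ c * ‖f x‖ := by
  constructor
  · intro hf
    have : CompleteSpace (LinearMap.range (f : E →ₗ[ℂ] F)) := hf.completeSpace_coe
    obtain ⟨c, -, hc⟩ := (f.rangeRestrict).exists_preimage_norm_le
      (by rintro ⟨_, x, rfl⟩; exact ⟨x, rfl⟩)
    refine ⟨c, fun x => ?_⟩
    obtain ⟨y, hy, hyc⟩ := hc ⟨f x, x, rfl⟩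
    have hy : f y = f x := congrArg Subtype.val hy
    exact ⟨x - y, by simp [hy], by simpa using hyc⟩
  · rintro ⟨c, hc⟩
    have hcl : IsClosed ((LinearMap.ker (f : E →ₗ[ℂ] F) : Submodule ℂ E) : Set E) :=
      f.isClosed_ker
    -- The induced operator on the quotient by the kernel is bounded below.
    let g := (LinearMap.ker (f : E →ₗ[ℂ] F)).liftQL f le_rfl
    have hg : AntilipschitzWith c.toNNReal g := by
      refine AddMonoidHomClass.antilipschitz_of_bound g fun z => ?_
      obtain ⟨x, rfl⟩ := Submodule.mkQ_surjective _ z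
      obtain ⟨w, hw, hxw⟩ := hc x
      have h1 : (LinearMap.ker (f : E →ₗ[ℂ] F)).mkQ x =
          (LinearMap.ker (f : E →ₗ[ℂ] F)).mkQ (x - w) :=
        (Submodule.Quotient.eq _).2 (by simpa using hw)
      calc _ = ‖(LinearMap.ker (f : E →ₗ[ℂ] F)).mkQ (x - w)‖ := by rw [h1]
        _ ≤ ‖x - w‖ := Submodule.Quotient.norm_mk_le _ _
        _ ≤ c * ‖f x‖ := hxw
        _ ≤ c.toNNReal * ‖f x‖ := by gcongr; exact Real.le_coe_toNNReal c
    have : Set.range f = Set.range g := by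
      ext y
      constructor
      · rintro ⟨x, rfl⟩
        exact ⟨Submodule.Quotient.mk x, rfl⟩
      · rintro ⟨z, rfl⟩
        obtain ⟨x, rfl⟩ := Submodule.mkQ_surjective _ z
        exact ⟨x, rfl⟩
    rw [this]
    exact hg.isClosed_range g.uniformContinuous

/-- The sum of `R` with the inclusion of a finite-dimensional complement of its range is onto, hence
has controlled preimages. -/
theorem isClosed_range_of_finiteDimensional_quotient [CompleteSpace E] [CompleteSpace F]
    (R : E →L[ℂ] F) [FiniteDimensional ℂ (F ⧸ LinearMap.range (R : E →ₗ[ℂ] F))] :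
    IsClosed (Set.range R) := by
  obtain ⟨G, hG⟩ := (LinearMap.range (R : E →ₗ[ℂ] F)).exists_isCompl
  have : FiniteDimensional ℂ G := (Submodule.quotientEquivOfIsCompl _ _ hG).finiteDimensional
  have : CompleteSpace G := FiniteDimensional.complete ℂ G
  obtain ⟨c, -, hc⟩ := (R.coprod G.subtypeL).exists_preimage_norm_le fun y => by
    obtain ⟨_, ⟨x, rfl⟩, g, hg, rfl⟩ :=
      Submodule.mem_sup.1 (hG.sup_eq_top ▸ Submodule.mem_top (x := y))
    exact ⟨(x, ⟨g, hg⟩), by simp⟩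
  refine (isClosed_range_iff_exists_norm_sub_le R).2 ⟨c, fun x => ?_⟩
  obtain ⟨⟨x', g⟩, hxg, hn⟩ := hc (R x)
  have hxg : R x' + g = R x := hxg
  have hgR : (g : F) = R (x - x') := by rw [map_sub, ← hxg, add_sub_cancel_left]
  have hg : (g : F) = 0 := by
    simpa using hG.disjoint.le_bot ⟨(⟨x - x', hgR.symm⟩ : (g : F) ∈ LinearMap.range _), g.2⟩
  refine ⟨x - x', by rw [← hgR, hg], ?_⟩
  rw [sub_sub_cancel]
  exact (norm_fst_le (x', g)).trans hn

/-- An operator which approximately solves `T x = y` with a relative error `1 / 2` and a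
controlled solution is onto: correct the errors successively. -/
theorem surjective_of_approx [CompleteSpace E] (T : E →L[ℂ] F) (c : ℝ)
    (h : ∀ y, ∃ x, ‖y - T x‖ ≤ 1 / 2 * ‖y‖ ∧ ‖x‖ ≤ c * ‖y‖) : Function.Surjective T := by
  choose g hg hgc using h
  intro y
  let r : ℕ → F := fun k => (fun z => z - T (g z))^[k] y
  have hr : ∀ k, r (k + 1) = r k - T (g (r k)) := fun k => Function.iterate_succ_apply' _ _ _
  have hrn : ∀ k, ‖r k‖ ≤ (1 / 2) ^ k * ‖y‖ := by
    intro k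
    induction k with
    | zero => simp [r]
    | succ k ih =>
      rw [hr, pow_succ']
      calc _ ≤ 1 / 2 * ‖r k‖ := hg _
        _ ≤ 1 / 2 * ((1 / 2) ^ k * ‖y‖) := by gcongr
        _ = _ := by ring
  have hsum : Summable fun k => g (r k) := by
    refine Summable.of_norm_bounded (g := fun k => |c| * ((1 / 2) ^ k * ‖y‖))
      ((summable_geometric_two.mul_right _).mul_left _) fun k => (hgc _).trans ?_
    calc _ ≤ |c| * ‖r k‖ := by gcongr; exact le_abs_self c
      _ ≤ _ := by gcongr; exact hrn k
  refine ⟨∑' k, g (r k), ?_⟩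
  have h1 : Filter.Tendsto (fun N => T (∑ k ∈ Finset.range N, g (r k))) Filter.atTop
      (nhds (T (∑' k, g (r k)))) :=
    (T.continuous.tendsto _).comp hsum.hasSum.tendsto_sum_nat
  have h2 : ∀ N, T (∑ k ∈ Finset.range N, g (r k)) = y - r N := by
    intro N
    induction N with
    | zero => simp [r]
    | succ N ih => rw [Finset.sum_range_succ, map_add, ih, hr]; abel
  have h3 : Filter.Tendsto r Filter.atTop (nhds 0) := by
    refine squeeze_zero_norm hrn ?_
    simpa using (tendsto_pow_atTop_nhds_zero_of_lt_one (r := (1 / 2 : ℝ)) (by norm_num)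
      (by norm_num)).mul_const ‖y‖
  refine tendsto_nhds_unique h1 ?_
  simp only [h2]
  simpa using h3.const_sub y

/-- If `T` is not onto, its transpose is not bounded below. -/
theorem exists_dual_norm_comp_le_of_not_surjective [CompleteSpace E] (T : E →L[ℂ] F)
    (hT : ¬ Function.Surjective T) {ε : ℝ} (hε : 0 < ε) :
    ∃ f : F →L[ℂ] ℂ, ‖f‖ = 1 ∧ ‖f.comp T‖ ≤ ε := by
  -- Some point of the `ε`-ball is not approximated by images of the unit ball.
  obtain ⟨y, hyε, hy⟩ : ∃ y : F, ‖y‖ ≤ ε ∧ y ∉ closure (T '' Metric.closedBall 0 1) := by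
    by_contra! hcon
    refine hT (surjective_of_approx T ε⁻¹ fun y => ?_)
    rcases eq_or_ne y 0 with rfl | hy0
    · exact ⟨0, by simp, by simp⟩
    have hyp : 0 < ‖y‖ := norm_pos_iff.2 hy0
    have hmem := hcon (((ε / ‖y‖ : ℝ) : ℂ) • y) (by
      rw [norm_smul, Complex.norm_real, Real.norm_of_nonneg (by positivity)]
      exact (div_mul_cancel₀ _ hyp.ne').le)
    obtain ⟨_, ⟨x, hx, rfl⟩, hd⟩ := Metric.mem_closure_iff.1 hmem (ε / 2) (by positivity)
    have hx : ‖x‖ ≤ 1 := by simpa using hx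
    have hinv : ((‖y‖ / ε : ℝ) : ℂ) * ((ε / ‖y‖ : ℝ) : ℂ) = 1 := by
      rw [← Complex.ofReal_mul]
      norm_cast
      field_simp
    refine ⟨((‖y‖ / ε : ℝ) : ℂ) • x, ?_, ?_⟩
    · have : y - T (((‖y‖ / ε : ℝ) : ℂ) • x) =
          ((‖y‖ / ε : ℝ) : ℂ) • (((ε / ‖y‖ : ℝ) : ℂ) • y - T x) := by
        rw [smul_sub, smul_smul, hinv, one_smul, map_smul]
      rw [this, norm_smul, Complex.norm_real, Real.norm_of_nonneg (by positivity)]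
      rw [dist_eq_norm] at hd
      calc _ ≤ ‖y‖ / ε * (ε / 2) := by gcongr
        _ = _ := by field_simp
    · rw [norm_smul, Complex.norm_real, Real.norm_of_nonneg (by positivity)]
      calc _ ≤ ‖y‖ / ε * 1 := by gcongr
        _ = _ := by ring
  -- A functional separating `y` from these images has the required small transpose.
  obtain ⟨f, s, hfs, hsy⟩ := RCLike.geometric_hahn_banach_closed_point (𝕜 := ℂ)
    ((convex_closedBall (0 : E) 1).is_linear_image
      ((T : E →ₗ[ℂ] F).restrictScalars ℝ).isLinear).closure isClosed_closure hy
  have hre : ∀ x : E, ‖x‖ ≤ 1 → (f (T x)).re < s := fun x hx =>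
    hfs _ (subset_closure ⟨x, by simpa using hx, rfl⟩)
  have hs : 0 < s := by simpa using hre 0 (by simp)
  have hnorm : ‖f.comp T‖ ≤ s := by
    refine ContinuousLinearMap.opNorm_le_of_unit_norm (𝕜 := ℂ) hs.le fun x hx => ?_
    obtain ⟨a, ha, hax⟩ := RCLike.exists_norm_eq_mul_self (f (T x))
    have := hre (a • x) (by rw [norm_smul, hx, ha, mul_one])
    rw [map_smul, map_smul, smul_eq_mul, ← hax] at this
    exact le_of_lt (by simpa using this)
  have hfy : s < ‖f‖ * ε := by
    calc s < (f y).re := hsy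
      _ ≤ ‖f y‖ := Complex.re_le_norm _
      _ ≤ ‖f‖ * ‖y‖ := f.le_opNorm y
      _ ≤ _ := by gcongr
  have hf : 0 < ‖f‖ := pos_of_mul_pos_left (hs.trans hfy) hε.le
  refine ⟨((‖f‖⁻¹ : ℝ) : ℂ) • f, ?_, ?_⟩
  · rw [norm_smul, Complex.norm_real, norm_inv, norm_norm, inv_mul_cancel₀ hf.ne']
  · rw [ContinuousLinearMap.smul_comp, norm_smul, Complex.norm_real, norm_inv, norm_norm,
      inv_mul_le_iff₀ hf]
    exact hnorm.trans hfy.le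

end Operators

/-! ### Splitting criteria for tuples -/

section Tuples

variable {X : Type*} [NormedAddCommGroup X] [NormedSpace ℂ X] {n : ℕ}

theorem rowMap_apply (T : Fin n → (X →L[ℂ] X)) (x : Fin n → X) :
    rowMap T x = ∑ i, T i (x i) := by
  simp [rowMap]

theorem rowMap_single (T : Fin n → (X →L[ℂ] X)) (j : Fin n) (x : X) :
    rowMap T (Pi.single j x) = T j x := by
  rw [rowMap_apply, Finset.sum_eq_single j]
  · rw [Pi.single_eq_same]
  · intro i _ hi
    rw [Pi.single_eq_of_ne hi, map_zero]
  · simp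

theorem range_rowMap (T : Fin n → (X →L[ℂ] X)) :
    LinearMap.range (rowMap T : (Fin n → X) →ₗ[ℂ] X) = rangeSum T := by
  apply le_antisymm
  · rintro _ ⟨x, rfl⟩
    change rowMap T x ∈ rangeSum T
    rw [rowMap_apply]
    exact Submodule.sum_mem _ fun i _ => Submodule.mem_iSup_of_mem i ⟨x i, rfl⟩
  · refine iSup_le fun i => ?_
    rintro _ ⟨x, rfl⟩
    exact ⟨Pi.single i x, rowMap_single T i x⟩

theorem isLowerSemiFredholm_iff (T : Fin n → (X →L[ℂ] X)) : IsLowerSemiFredholm T ↔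
    FiniteDimensional ℂ (X ⧸ LinearMap.range (rowMap T : (Fin n → X) →ₗ[ℂ] X)) := by
  rw [range_rowMap, IsLowerSemiFredholm]

theorem mem_ker_colMap {T : Fin n → (X →L[ℂ] X)} {x : X} :
    x ∈ LinearMap.ker (colMap T : X →ₗ[ℂ] (Fin n → X)) ↔ ∀ i, T i x = 0 :=
  funext_iff

/-- A tuple splits as a lower semi-Fredholm tuple if and only if it has a right inverse modulo
finite rank operators. -/
theorem notMem_spDeltaE_iff [CompleteSpace X] {T : Fin n → (X →L[ℂ] X)} {lam : Fin n → ℂ} :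
    lam ∉ spDeltaE T ↔ ∃ (A : Fin n → (X →L[ℂ] X)) (K : X →L[ℂ] X),
      FiniteDimensional ℂ (LinearMap.range (K : X →ₗ[ℂ] X)) ∧
        ∑ i, (shift T lam i).comp (A i) = ContinuousLinearMap.id ℂ X - K := by
  simp only [spDeltaE, Set.mem_union, not_or, sigmaPhiMinus, CMinus, Set.mem_ofPred_eq, not_not,
    isLowerSemiFredholm_iff]
  constructor
  · rintro ⟨hfin, hker⟩
    obtain ⟨G, hG⟩ :=
      (LinearMap.range (rowMap (shift T lam) : (Fin n → X) →ₗ[ℂ] X)).exists_isCompl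
    have : FiniteDimensional ℂ G := (Submodule.quotientEquivOfIsCompl _ _ hG).finiteDimensional
    obtain ⟨W, K, hK, hW⟩ := exists_rightInverse_sub _ hker G hG
    refine ⟨fun i => (ContinuousLinearMap.proj i).comp W, K, ?_, ?_⟩
    · refine Submodule.finiteDimensional_of_le (S₂ := G) ?_
      rintro _ ⟨x, rfl⟩
      exact hK x
    · ext y
      simpa [rowMap_apply] using hW y
  · rintro ⟨A, K, hK, h⟩
    have h : ∀ y, rowMap (shift T lam) (ContinuousLinearMap.pi A y) = y - K y := fun y => by
      simpa [rowMap_apply] using DFunLike.congr_fun h y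
    exact ⟨finiteDimensional_quotient_range_of_comp_eq_sub _ _ K h,
      closedComplemented_ker_of_comp_eq_sub _ _ K h⟩

theorem notMem_spDelta_iff [CompleteSpace X] {T : Fin n → (X →L[ℂ] X)} {lam : Fin n → ℂ} :
    lam ∉ spDelta T ↔ ∃ A : Fin n → (X →L[ℂ] X),
      ∑ i, (shift T lam i).comp (A i) = ContinuousLinearMap.id ℂ X := by
  simp only [spDelta, Set.mem_union, not_or, sigmaDelta, CMinus, Set.mem_ofPred_eq, not_not,
    ne_eq, ← range_rowMap]
  constructor
  · rintro ⟨htop, hker⟩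
    obtain ⟨W, K, hK, hW⟩ := exists_rightInverse_sub _ hker ⊥ (htop ▸ isCompl_top_bot)
    refine ⟨fun i => (ContinuousLinearMap.proj i).comp W, ?_⟩
    ext y
    have : K y = 0 := hK y
    simpa [rowMap_apply, this] using hW y
  · rintro ⟨A, h⟩
    have h : ∀ y, rowMap (shift T lam) (ContinuousLinearMap.pi A y) = y := fun y => by
      simpa [rowMap_apply] using DFunLike.congr_fun h y
    exact ⟨LinearMap.range_eq_top.2 fun y => ⟨_, h y⟩,
      ContinuousLinearMap.closedComplemented_ker_of_rightInverse _ _ h⟩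

/-- A tuple splits as an upper semi-Fredholm tuple if and only if it has a left inverse modulo
finite rank operators. -/
theorem notMem_spPiE_iff [CompleteSpace X] {T : Fin n → (X →L[ℂ] X)} {lam : Fin n → ℂ} :
    lam ∉ spPiE T ↔ ∃ (A : Fin n → (X →L[ℂ] X)) (K : X →L[ℂ] X),
      FiniteDimensional ℂ (LinearMap.range (K : X →ₗ[ℂ] X)) ∧
        ∑ i, (A i).comp (shift T lam i) = ContinuousLinearMap.id ℂ X - K := by
  simp only [spPiE, Set.mem_union, not_or, sigmaPhiPlus, CPlus, Set.mem_ofPred_eq, not_not,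
    IsUpperSemiFredholm]
  constructor
  · rintro ⟨⟨hfin, -⟩, hran⟩
    obtain ⟨W, K, hK, hW⟩ := exists_leftInverse_sub _ hran
    refine ⟨fun i => W.comp (ContinuousLinearMap.single ℂ (fun _ : Fin n => X) i), K, ?_, ?_⟩
    · refine Submodule.finiteDimensional_of_le ?_
        (S₂ := LinearMap.ker (colMap (shift T lam) : X →ₗ[ℂ] (Fin n → X)))
      rintro _ ⟨x, rfl⟩
      exact hK x
    · ext y
      have := hW y
      rw [← ContinuousLinearMap.sum_comp_single] at this
      simpa [colMap] using this
  · rintro ⟨A, K, hK, h⟩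
    have h : ∀ y, rowMap A (colMap (shift T lam) y) = y - K y := fun y => by
      simpa [rowMap_apply, colMap] using DFunLike.congr_fun h y
    have hc := closedComplemented_range_of_comp_eq_sub _ _ K h
    refine ⟨⟨finiteDimensional_ker_of_comp_eq_sub _ _ K h, hc.isClosed⟩, hc⟩

theorem notMem_spPi_iff [CompleteSpace X] {T : Fin n → (X →L[ℂ] X)} {lam : Fin n → ℂ} :
    lam ∉ spPi T ↔ ∃ A : Fin n → (X →L[ℂ] X),
      ∑ i, (A i).comp (shift T lam i) = ContinuousLinearMap.id ℂ X := by
  simp only [spPi, Set.mem_union, not_or, sigmaPi, CPlus, Set.mem_ofPred_eq, not_not, ne_eq]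
  constructor
  · rintro ⟨⟨hker, -⟩, hran⟩
    have : FiniteDimensional ℂ (LinearMap.ker (colMap (shift T lam) : X →ₗ[ℂ] (Fin n → X))) := by
      rw [hker]; infer_instance
    obtain ⟨W, K, hK, hW⟩ := exists_leftInverse_sub _ hran
    refine ⟨fun i => W.comp (ContinuousLinearMap.single ℂ (fun _ : Fin n => X) i), ?_⟩
    ext y
    have hKy : K y = 0 := by simpa [hker] using hK y
    have := hW y
    rw [← ContinuousLinearMap.sum_comp_single] at this
    simpa [colMap, hKy] using this
  · rintro ⟨A, h⟩
    have h : ∀ y, rowMap A (colMap (shift T lam) y) = y := fun y => by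
      simpa [rowMap_apply, colMap] using DFunLike.congr_fun h y
    have hc := ContinuousLinearMap.closedComplemented_range_of_leftInverse _ _ h
    refine ⟨⟨?_, hc.isClosed⟩, hc⟩
    exact LinearMap.ker_eq_bot.2 (Function.LeftInverse.injective h)

theorem sigmaPhiMinus_subset_sigmaDelta (T : Fin n → (X →L[ℂ] X)) :
    sigmaPhiMinus T ⊆ sigmaDelta T := fun lam h htop => h <| by
  rw [IsLowerSemiFredholm, htop]
  infer_instance

theorem sigmaPhiPlus_subset_sigmaPi (T : Fin n → (X →L[ℂ] X)) :
    sigmaPhiPlus T ⊆ sigmaPi T := fun lam h => by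
  by_contra hcon
  obtain ⟨hker, hran⟩ := not_or.1 hcon
  refine h ⟨?_, not_not.1 hran⟩
  rw [not_not.1 hker]
  infer_instance

/-- The column map has closed range if and only if the norms `‖Tᵢ x‖` dominate the distance from
`x` to the joint kernel. -/
theorem isClosed_range_colMap_iff [CompleteSpace X] {T : Fin n → (X →L[ℂ] X)} :
    IsClosed (Set.range (colMap T)) ↔
      ∃ c : ℝ, 0 ≤ c ∧ ∀ x, ∃ w, (∀ i, T i w = 0) ∧ ‖x - w‖ ≤ c * ∑ i, ‖T i x‖ := by
  rw [isClosed_range_iff_exists_norm_sub_le]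
  constructor
  · rintro ⟨c, hc⟩
    refine ⟨|c|, abs_nonneg c, fun x => ?_⟩
    obtain ⟨w, hw, hxw⟩ := hc x
    refine ⟨w, funext_iff.1 hw, hxw.trans ?_⟩
    gcongr
    · exact le_abs_self c
    · exact (pi_norm_le_iff_of_nonneg (by positivity)).2 fun i =>
        Finset.single_le_sum (f := fun i => ‖T i x‖) (fun _ _ => norm_nonneg _) (Finset.mem_univ i)
  · rintro ⟨c, hc0, hc⟩
    refine ⟨c * n, fun x => ?_⟩
    obtain ⟨w, hw, hxw⟩ := hc x
    refine ⟨w, funext hw, hxw.trans ?_⟩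
    rw [mul_assoc]
    gcongr
    refine (Finset.sum_le_card_nsmul _ _ ‖colMap T x‖ fun i _ => ?_).trans (by simp)
    exact norm_le_pi_norm (colMap T x) i

/-- A tuple whose column map does not have closed range has approximate joint null vectors. -/
theorem exists_norm_eq_one_sum_le [CompleteSpace X] {T : Fin n → (X →L[ℂ] X)}
    (hT : ¬ IsClosed (Set.range (colMap T))) {ε : ℝ} (hε : 0 < ε) :
    ∃ x, ‖x‖ = 1 ∧ ∑ i, ‖T i x‖ ≤ ε := by
  by_contra! hcon
  refine hT (isClosed_range_colMap_iff.2 ⟨ε⁻¹, by positivity, fun x => ⟨0, by simp, ?_⟩⟩)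
  rcases eq_or_ne x 0 with rfl | hx
  · simp
  have hxp : 0 < ‖x‖ := norm_pos_iff.2 hx
  have := hcon (((‖x‖⁻¹ : ℝ) : ℂ) • x) (by
    rw [norm_smul, Complex.norm_real, norm_inv, norm_norm, inv_mul_cancel₀ hxp.ne'])
  simp only [map_smul, norm_smul, Complex.norm_real, norm_inv, norm_norm, ← Finset.mul_sum] at this
  rw [lt_inv_mul_iff₀ hxp] at this
  rw [sub_zero, le_inv_mul_iff₀ hε, mul_comm]
  exact this.le

theorem exists_norm_eq_one_of_ker_ne_bot {T : Fin n → (X →L[ℂ] X)}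
    (h : LinearMap.ker (colMap T : X →ₗ[ℂ] (Fin n → X)) ≠ ⊥) :
    ∃ y, ‖y‖ = 1 ∧ ∀ j, T j y = 0 := by
  obtain ⟨y, hy, hy0⟩ := Submodule.exists_mem_ne_zero_of_ne_bot h
  rw [mem_ker_colMap] at hy
  refine ⟨((‖y‖⁻¹ : ℝ) : ℂ) • y, ?_, fun j => by simp [hy j]⟩
  rw [norm_smul, Complex.norm_real, norm_inv, norm_norm, inv_mul_cancel₀ (norm_ne_zero_iff.2 hy0)]

theorem rangeSum_comp_equiv {k : ℕ} (T : Fin n → (X →L[ℂ] X)) (e : Fin k ≃ Fin n) :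
    rangeSum (T ∘ e) = rangeSum T :=
  e.iSup_comp (g := fun i => LinearMap.range (T i : X →ₗ[ℂ] X))

theorem IsUpperSemiFredholm.comp_equiv [CompleteSpace X] {k : ℕ} {T : Fin n → (X →L[ℂ] X)}
    (h : IsUpperSemiFredholm T) (e : Fin k ≃ Fin n) : IsUpperSemiFredholm (T ∘ e) := by
  have hall : ∀ x, (∀ i, (T ∘ e) i x = 0) ↔ ∀ i, T i x = 0 := fun x =>
    e.forall_congr_left.trans (by simp)
  constructor
  · have hker : LinearMap.ker (colMap (T ∘ e) : X →ₗ[ℂ] (Fin k → X)) =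
        LinearMap.ker (colMap T : X →ₗ[ℂ] (Fin n → X)) := by
      ext x
      rw [mem_ker_colMap, mem_ker_colMap, hall]
    rw [hker]
    exact h.1
  · have := h.2
    rw [isClosed_range_colMap_iff] at this ⊢
    simp only [hall]
    simpa only [Function.comp_apply, fun x => e.sum_comp fun i => ‖T i x‖] using this

end Tuples

/-! ### Closed subspaces of powers of a Hilbert space -/

theorem closedComplemented_of_isInnerProductNorm {X : Type*} [NormedAddCommGroup X]
    [h : NormedSpace ℂ X] [CompleteSpace X] (hX : IsInnerProductNorm X) {n : ℕ}
    (M : Submodule ℂ (Fin n → X)) (hM : IsClosed (M : Set (Fin n → X))) :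
    M.ClosedComplemented := by
  obtain ⟨inst, rfl⟩ := hX
  -- The Euclidean norm turns `Xⁿ` into a Hilbert space with the same topology.
  let e := PiLp.continuousLinearEquiv 2 ℂ (fun _ : Fin n => X)
  let N : Submodule ℂ (PiLp 2 fun _ : Fin n => X) := M.comap (e : _ →ₗ[ℂ] (Fin n → X))
  have hN : IsClosed (N : Set (PiLp 2 fun _ : Fin n => X)) := hM.preimage e.continuous
  have : CompleteSpace N := hN.completeSpace_coe
  refine ⟨((e : _ →L[ℂ] (Fin n → X)).comp (N.starProjection.comp
    (e.symm : (Fin n → X) →L[ℂ] _))).codRestrict M fun x => ?_, fun x => ?_⟩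
  · exact Submodule.starProjection_apply_mem N (e.symm x)
  · have hx : e.symm x ∈ N := by
      change e (e.symm x) ∈ M
      simp
    ext1
    change e (N.starProjection (e.symm x)) = x
    rw [Submodule.starProjection_eq_self_iff.2 hx, e.apply_symm_apply]

section Hilbert

variable {X : Type*} [NormedAddCommGroup X] [NormedSpace ℂ X] [CompleteSpace X] {n : ℕ}

theorem CMinus_eq_empty (hX : IsInnerProductNorm X) (T : Fin n → (X →L[ℂ] X)) : CMinus T = ∅ :=
  Set.eq_empty_of_forall_notMem fun lam h => h
    (closedComplemented_of_isInnerProductNorm hX _ (rowMap (shift T lam)).isClosed_ker)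

theorem isClosed_range_notMem_CPlus (hX : IsInnerProductNorm X) (T : Fin n → (X →L[ℂ] X))
    {lam : Fin n → ℂ} (h : IsClosed (Set.range (colMap (shift T lam)))) : lam ∉ CPlus T :=
  fun hl => hl (closedComplemented_of_isInnerProductNorm hX _ h)

theorem spDelta_eq (hX : IsInnerProductNorm X) (T : Fin n → (X →L[ℂ] X)) :
    spDelta T = sigmaDelta T := by
  rw [spDelta, CMinus_eq_empty hX, Set.union_empty]

theorem spDeltaE_eq (hX : IsInnerProductNorm X) (T : Fin n → (X →L[ℂ] X)) :
    spDeltaE T = sigmaPhiMinus T := by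
  rw [spDeltaE, CMinus_eq_empty hX, Set.union_empty]

theorem spPi_eq (hX : IsInnerProductNorm X) (T : Fin n → (X →L[ℂ] X)) :
    spPi T = sigmaPi T :=
  Set.union_eq_self_of_subset_right fun _ hl =>
    Or.inr fun h => isClosed_range_notMem_CPlus hX T h hl

theorem spPiE_eq (hX : IsInnerProductNorm X) (T : Fin n → (X →L[ℂ] X)) :
    spPiE T = sigmaPhiPlus T :=
  Set.union_eq_self_of_subset_right fun _ hl h => isClosed_range_notMem_CPlus hX T h.2 hl

end Hilbert

/-! ### Slices of an Eschmeier tensor product -/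

namespace BanachTensor

variable {X Y Z : Type*} [NormedAddCommGroup X] [NormedSpace ℂ X]
  [NormedAddCommGroup Y] [NormedSpace ℂ Y] [NormedAddCommGroup Z] [NormedSpace ℂ Z]
  {n m : ℕ}

/-- The same tensor product with the two factors exchanged. -/
noncomputable def flip (P : BanachTensor X Y Z) : BanachTensor Y X Z where
  vec := P.vec.flip
  op := P.op.flip
  norm_vec y x := by simp [P.norm_vec, mul_comm]
  op_vec B A y x := P.op_vec A B x y
  op_comp B₁ A₁ B₂ A₂ := P.op_comp A₁ B₁ A₂ B₂
  op_id := P.op_id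
  range_left := P.range_right
  range_right := P.range_left

theorem flip_tuple (P : BanachTensor X Y Z) (S : Fin n → (X →L[ℂ] X)) (T : Fin m → (Y →L[ℂ] Y)) :
    P.flip.tuple T S = P.tuple S T ∘ finAddFlip := by
  ext i : 1
  refine Fin.addCases (fun j => ?_) (fun j => ?_) i
  · simp [tuple, flip]
  · simp [tuple, flip]

theorem shift_tuple (P : BanachTensor X Y Z) (S : Fin n → (X →L[ℂ] X)) (T : Fin m → (Y →L[ℂ] Y))
    (lam : Fin n → ℂ) (mu : Fin m → ℂ) :
    shift (P.tuple S T) (Fin.append lam mu) = P.tuple (shift S lam) (shift T mu) := by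
  ext i : 1
  refine Fin.addCases (fun j => ?_) (fun j => ?_) i
  · simp [tuple, shift, P.op_id]
  · simp [tuple, shift, P.op_id]

theorem op_op (P : BanachTensor X Y Z) (A₁ A₂ : X →L[ℂ] X) (B₁ B₂ : Y →L[ℂ] Y) (z : Z) :
    P.op A₁ B₁ (P.op A₂ B₂ z) = P.op (A₁.comp A₂) (B₁.comp B₂) z :=
  DFunLike.congr_fun (P.op_comp A₁ B₁ A₂ B₂) z

/-- The slice maps `x ⊗ y ↦ v(y) x`: fixing a unit vector `y₀`, the operator `I ⊗ f_{y₀,v}` takes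
its values in `X ⊗ y₀`, an isometric copy of `X`. -/
theorem exists_slice (P : BanachTensor X Y Z) [Nontrivial Y] :
    ∃ (c : ℝ) (φ : (Y →L[ℂ] ℂ) → (Z →L[ℂ] X)), 0 ≤ c ∧ (∀ v z, ‖φ v z‖ ≤ c * ‖v‖ * ‖z‖) ∧
      (∀ v x y, φ v (P.vec x y) = v y • x) ∧
      (∀ v A z, φ v (P.op A (ContinuousLinearMap.id ℂ Y) z) = A (φ v z)) ∧
      ∀ v B z, φ v (P.op (ContinuousLinearMap.id ℂ X) B z) = φ (v.comp B) z := by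
  obtain ⟨y₀, hy₀⟩ := exists_norm_eq Y zero_le_one
  have hnorm : ∀ x, ‖P.vec x y₀‖ = ‖x‖ := fun x => by rw [P.norm_vec, hy₀, mul_one]
  have hinj : ∀ x x', P.vec x y₀ = P.vec x' y₀ → x = x' := fun x x' h => by
    rw [← sub_eq_zero, ← norm_eq_zero, ← hnorm, map_sub, sub_apply, h, sub_self,
      norm_zero]
  choose g hg using fun (v : Y →L[ℂ] ℂ) (z : Z) =>
    P.range_right y₀ v ⟨z, rfl⟩
  have hbound : ∀ v z, ‖g v z‖ ≤ ‖P.op (ContinuousLinearMap.id ℂ X)‖ * ‖v‖ * ‖z‖ := fun v z => by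
    rw [← hnorm, ← hg]
    calc _ ≤ ‖P.op (ContinuousLinearMap.id ℂ X) (v.smulRight y₀)‖ * ‖z‖ :=
        ContinuousLinearMap.le_opNorm _ _
      _ ≤ ‖P.op (ContinuousLinearMap.id ℂ X)‖ * ‖v.smulRight y₀‖ * ‖z‖ := by
        gcongr
        exact ContinuousLinearMap.le_opNorm _ _
      _ = _ := by rw [ContinuousLinearMap.norm_smulRight_apply, hy₀, mul_one]
  let φ : (Y →L[ℂ] ℂ) → (Z →L[ℂ] X) := fun v => LinearMap.mkContinuous
    { toFun := g v
      map_add' := fun z z' => hinj _ _ (by simp [← hg])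
      map_smul' := fun a z => hinj _ _ (by simp [← hg]) } _ (hbound v)
  have hφ : ∀ v z, P.op (ContinuousLinearMap.id ℂ X) (v.smulRight y₀) z = P.vec (φ v z) y₀ := hg
  refine ⟨‖P.op (ContinuousLinearMap.id ℂ X)‖, φ, ContinuousLinearMap.opNorm_nonneg _, hbound,
    fun v x y => hinj _ _ ?_, fun v A z => hinj _ _ ?_, fun v B z => hinj _ _ ?_⟩
  · simp [← hφ, P.op_vec]
  · rw [← hφ, op_op, ContinuousLinearMap.id_comp, ContinuousLinearMap.comp_id]
    have := P.op_vec A (ContinuousLinearMap.id ℂ Y) (φ v z) y₀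
    rw [← hφ, op_op, ContinuousLinearMap.id_comp, ContinuousLinearMap.comp_id] at this
    exact this
  · rw [← hφ, ← hφ, op_op, ContinuousLinearMap.id_comp]
    rfl

/-- The tensor product of two rank one operators has rank at most one. -/
theorem op_smulRight_smulRight (P : BanachTensor X Y Z) (u : X →L[ℂ] ℂ) (x : X) (v : Y →L[ℂ] ℂ)
    (y : Y) (z : Z) : ∃ a : ℂ, P.op (u.smulRight x) (v.smulRight y) z = a • P.vec x y := by
  obtain ⟨x', hx'⟩ := P.range_right y v ⟨z, rfl⟩
  refine ⟨u x', ?_⟩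
  have := P.op_op (u.smulRight x) (ContinuousLinearMap.id ℂ X) (ContinuousLinearMap.id ℂ Y)
    (v.smulRight y) z
  rw [ContinuousLinearMap.id_comp, ContinuousLinearMap.comp_id] at this
  rw [← this, hx', P.op_vec]
  simp

end BanachTensor

theorem exists_eq_sum_smulRight {X : Type*} [NormedAddCommGroup X] [NormedSpace ℂ X]
    (F : X →L[ℂ] X) [FiniteDimensional ℂ (LinearMap.range (F : X →ₗ[ℂ] X))] :
    ∃ (d : ℕ) (u : Fin d → (X →L[ℂ] ℂ)) (x : Fin d → X), F = ∑ k, (u k).smulRight (x k) := by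
  let b := Module.finBasis ℂ (LinearMap.range (F : X →ₗ[ℂ] X))
  refine ⟨_, fun k => (LinearMap.toContinuousLinearMap (b.coord k)).comp F.rangeRestrict,
    fun k => b k, ?_⟩
  ext z
  have := congrArg Subtype.val (b.sum_repr (F.rangeRestrict z))
  simpa [Module.Basis.coord_apply] using! this.symm

/-! ### One-sided inverses of tensor tuples -/

namespace BanachTensor

variable {X Y Z : Type*} [NormedAddCommGroup X] [NormedSpace ℂ X]
  [NormedAddCommGroup Y] [NormedSpace ℂ Y] [NormedAddCommGroup Z] [NormedSpace ℂ Z]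
  {n m : ℕ}

theorem finiteDimensional_range_op (P : BanachTensor X Y Z) (F : X →L[ℂ] X) (G : Y →L[ℂ] Y)
    [FiniteDimensional ℂ (LinearMap.range (F : X →ₗ[ℂ] X))]
    [FiniteDimensional ℂ (LinearMap.range (G : Y →ₗ[ℂ] Y))] :
    FiniteDimensional ℂ (LinearMap.range (P.op F G : Z →ₗ[ℂ] Z)) := by
  obtain ⟨d, u, x, rfl⟩ := exists_eq_sum_smulRight F
  obtain ⟨e, v, y, rfl⟩ := exists_eq_sum_smulRight G
  have : FiniteDimensional ℂ (Submodule.span ℂ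
      (Set.range fun p : Fin d × Fin e => P.vec (x p.1) (y p.2))) :=
    FiniteDimensional.span_of_finite ℂ (Set.finite_range _)
  refine Submodule.finiteDimensional_of_le (S₂ := Submodule.span ℂ
    (Set.range fun p : Fin d × Fin e => P.vec (x p.1) (y p.2))) ?_
  rintro _ ⟨z, rfl⟩
  simp only [map_sum, ContinuousLinearMap.coe_coe, sum_apply]
  refine Submodule.sum_mem _ fun k _ => Submodule.sum_mem _ fun l _ => ?_
  obtain ⟨a, ha⟩ := P.op_smulRight_smulRight (u l) (x l) (v k) (y k) z
  rw [ha]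
  exact Submodule.smul_mem _ _ (Submodule.subset_span ⟨(l, k), rfl⟩)

theorem op_sub_left (P : BanachTensor X Y Z) (F : X →L[ℂ] X) (B : Y →L[ℂ] Y) :
    P.op (ContinuousLinearMap.id ℂ X - F) B = P.op (ContinuousLinearMap.id ℂ X) B - P.op F B := by
  rw [map_sub, sub_apply]

/-- `I - F ⊗ G = (I - F) ⊗ I + F ⊗ (I - G)` combines right inverses modulo the finite rank
operators `F` and `G` into one modulo `F ⊗ G`. -/
theorem append_notMem_spDeltaE [CompleteSpace X] [CompleteSpace Y] [CompleteSpace Z]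
    (P : BanachTensor X Y Z) {S : Fin n → (X →L[ℂ] X)}
    {T : Fin m → (Y →L[ℂ] Y)} {lam : Fin n → ℂ} {mu : Fin m → ℂ}
    (hS : lam ∉ spDeltaE S) (hT : mu ∉ spDeltaE T) :
    Fin.append lam mu ∉ spDeltaE (P.tuple S T) := by
  rw [notMem_spDeltaE_iff] at hS hT ⊢
  obtain ⟨A, F, hF, hA⟩ := hS
  obtain ⟨B, G, hG, hB⟩ := hT
  refine ⟨Fin.append (fun i => P.op (A i) (ContinuousLinearMap.id ℂ Y)) (fun j => P.op F (B j)),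
    P.op F G, P.finiteDimensional_range_op F G, ?_⟩
  rw [shift_tuple, Fin.sum_univ_add]
  simp only [tuple, Fin.append_left, Fin.append_right, P.op_comp, ContinuousLinearMap.id_comp]
  have h1 := congrArg (fun C => P.op C (ContinuousLinearMap.id ℂ Y)) hA
  have h2 := congrArg (P.op F) hB
  simp only [map_sum, sum_apply, op_sub_left, P.op_id] at h1
  rw [map_sum, map_sub] at h2
  rw [h1, h2]
  abel

theorem append_notMem_spPiE [CompleteSpace X] [CompleteSpace Y] [CompleteSpace Z]
    (P : BanachTensor X Y Z) {S : Fin n → (X →L[ℂ] X)}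
    {T : Fin m → (Y →L[ℂ] Y)} {lam : Fin n → ℂ} {mu : Fin m → ℂ}
    (hS : lam ∉ spPiE S) (hT : mu ∉ spPiE T) :
    Fin.append lam mu ∉ spPiE (P.tuple S T) := by
  rw [notMem_spPiE_iff] at hS hT ⊢
  obtain ⟨A, F, hF, hA⟩ := hS
  obtain ⟨B, G, hG, hB⟩ := hT
  refine ⟨Fin.append (fun i => P.op (A i) (ContinuousLinearMap.id ℂ Y)) (fun j => P.op F (B j)),
    P.op F G, P.finiteDimensional_range_op F G, ?_⟩
  rw [shift_tuple, Fin.sum_univ_add]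
  simp only [tuple, Fin.append_left, Fin.append_right, P.op_comp,
    ContinuousLinearMap.comp_id]
  have h1 := congrArg (fun C => P.op C (ContinuousLinearMap.id ℂ Y)) hA
  have h2 := congrArg (P.op F) hB
  simp only [map_sum, sum_apply, op_sub_left, P.op_id] at h1
  rw [map_sum, map_sub] at h2
  rw [h1, h2]
  abel

theorem append_notMem_spDelta_left [CompleteSpace X] [CompleteSpace Z]
    (P : BanachTensor X Y Z) {S : Fin n → (X →L[ℂ] X)}
    (T : Fin m → (Y →L[ℂ] Y)) {lam : Fin n → ℂ} (mu : Fin m → ℂ) (hS : lam ∉ spDelta S) :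
    Fin.append lam mu ∉ spDelta (P.tuple S T) := by
  rw [notMem_spDelta_iff] at hS ⊢
  obtain ⟨A, hA⟩ := hS
  refine ⟨Fin.append (fun i => P.op (A i) (ContinuousLinearMap.id ℂ Y)) (fun _ => 0), ?_⟩
  rw [shift_tuple, Fin.sum_univ_add]
  have h1 := congrArg (fun C => P.op C (ContinuousLinearMap.id ℂ Y)) hA
  simpa [tuple, P.op_comp, P.op_id] using h1

theorem append_notMem_spDelta_right [CompleteSpace Y] [CompleteSpace Z]
    (P : BanachTensor X Y Z) (S : Fin n → (X →L[ℂ] X))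
    {T : Fin m → (Y →L[ℂ] Y)} (lam : Fin n → ℂ) {mu : Fin m → ℂ} (hT : mu ∉ spDelta T) :
    Fin.append lam mu ∉ spDelta (P.tuple S T) := by
  rw [notMem_spDelta_iff] at hT ⊢
  obtain ⟨B, hB⟩ := hT
  refine ⟨Fin.append (fun _ => 0) (fun j => P.op (ContinuousLinearMap.id ℂ X) (B j)), ?_⟩
  rw [shift_tuple, Fin.sum_univ_add]
  have h1 := congrArg (P.op (ContinuousLinearMap.id ℂ X)) hB
  simpa [tuple, P.op_comp, P.op_id] using h1

theorem append_notMem_spPi_left [CompleteSpace X] [CompleteSpace Z]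
    (P : BanachTensor X Y Z) {S : Fin n → (X →L[ℂ] X)}
    (T : Fin m → (Y →L[ℂ] Y)) {lam : Fin n → ℂ} (mu : Fin m → ℂ) (hS : lam ∉ spPi S) :
    Fin.append lam mu ∉ spPi (P.tuple S T) := by
  rw [notMem_spPi_iff] at hS ⊢
  obtain ⟨A, hA⟩ := hS
  refine ⟨Fin.append (fun i => P.op (A i) (ContinuousLinearMap.id ℂ Y)) (fun _ => 0), ?_⟩
  rw [shift_tuple, Fin.sum_univ_add]
  have h1 := congrArg (fun C => P.op C (ContinuousLinearMap.id ℂ Y)) hA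
  simpa [tuple, P.op_comp, P.op_id] using h1

theorem append_notMem_spPi_right [CompleteSpace Y] [CompleteSpace Z]
    (P : BanachTensor X Y Z) (S : Fin n → (X →L[ℂ] X))
    {T : Fin m → (Y →L[ℂ] Y)} (lam : Fin n → ℂ) {mu : Fin m → ℂ} (hT : mu ∉ spPi T) :
    Fin.append lam mu ∉ spPi (P.tuple S T) := by
  rw [notMem_spPi_iff] at hT ⊢
  obtain ⟨B, hB⟩ := hT
  refine ⟨Fin.append (fun _ => 0) (fun j => P.op (ContinuousLinearMap.id ℂ X) (B j)), ?_⟩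
  rw [shift_tuple, Fin.sum_univ_add]
  have h1 := congrArg (P.op (ContinuousLinearMap.id ℂ X)) hB
  simpa [tuple, P.op_comp, P.op_id] using h1

end BanachTensor

/-! ### Semi-Fredholm tensor tuples -/

namespace BanachTensor

variable {X Y Z : Type*} [NormedAddCommGroup X] [NormedSpace ℂ X]
  [NormedAddCommGroup Y] [NormedSpace ℂ Y] [NormedAddCommGroup Z] [NormedSpace ℂ Z]
  {n m : ℕ}

theorem rangeSum_flip_tuple (P : BanachTensor X Y Z) (S : Fin n → (X →L[ℂ] X))
    (T : Fin m → (Y →L[ℂ] Y)) : rangeSum (P.flip.tuple T S) = rangeSum (P.tuple S T) := by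
  rw [flip_tuple]
  exact rangeSum_comp_equiv _ _

/-- The slice by a functional annihilating `M₁(T)` maps `M₁` of the tensor tuple into `M₁(S)`. -/
theorem isLowerSemiFredholm_left_of_dual (P : BanachTensor X Y Z) {S : Fin n → (X →L[ℂ] X)}
    {T : Fin m → (Y →L[ℂ] Y)} (h : IsLowerSemiFredholm (P.tuple S T)) {v : Y →L[ℂ] ℂ}
    (hv : v ≠ 0) (hvT : ∀ j, v.comp (T j) = 0) : IsLowerSemiFredholm S := by
  obtain ⟨y, hy⟩ : ∃ y, v y ≠ 0 := by
    by_contra! hcon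
    exact hv (ContinuousLinearMap.ext hcon)
  have : Nontrivial Y := ⟨y, 0, by rintro rfl; simp at hy⟩
  obtain ⟨c, φ, hc, hφ, hvec, hleft, hright⟩ := P.exists_slice
  have hzero : ∀ z, φ 0 z = 0 := fun z => by simpa using hφ 0 z
  have hle : rangeSum (P.tuple S T) ≤ (rangeSum S).comap (φ v : Z →ₗ[ℂ] X) := by
    refine iSup_le fun i => ?_
    rintro _ ⟨z, rfl⟩
    refine Fin.addCases (fun i => ?_) (fun j => ?_) i
    · simp only [tuple, Fin.append_left, Submodule.mem_comap, ContinuousLinearMap.coe_coe, hleft]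
      exact Submodule.mem_iSup_of_mem i ⟨φ v z, rfl⟩
    · simp [tuple, hright, hvT, hzero]
  have : FiniteDimensional ℂ (Z ⧸ rangeSum (P.tuple S T)) := h
  refine FiniteDimensional.of_surjective (Submodule.mapQ _ _ (φ v : Z →ₗ[ℂ] X) hle) fun q => ?_
  obtain ⟨x, rfl⟩ := Submodule.mkQ_surjective _ q
  refine ⟨Submodule.Quotient.mk (P.vec ((v y)⁻¹ • x) y), ?_⟩
  rw [Submodule.mapQ_apply]
  simp only [ContinuousLinearMap.coe_coe, hvec, smul_smul, mul_inv_cancel₀ hy, one_smul]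
  rfl

end BanachTensor

section

variable {X : Type*} [NormedAddCommGroup X] [NormedSpace ℂ X] {n : ℕ}

theorem IsLowerSemiFredholm.isClosed_rangeSum [CompleteSpace X] {T : Fin n → (X →L[ℂ] X)}
    (h : IsLowerSemiFredholm T) : IsClosed (rangeSum T : Set X) := by
  rw [isLowerSemiFredholm_iff] at h
  rw [← range_rowMap]
  exact isClosed_range_of_finiteDimensional_quotient _

theorem exists_dual_comp_eq_zero {T : Fin n → (X →L[ℂ] X)}
    (h : (rangeSum T).topologicalClosure ≠ ⊤) :
    ∃ v : X →L[ℂ] ℂ, v ≠ 0 ∧ ∀ j, v.comp (T j) = 0 := by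
  obtain ⟨x, hx⟩ : ∃ x, x ∉ (rangeSum T).topologicalClosure := by
    by_contra! hcon
    exact h (Submodule.eq_top_iff'.2 hcon)
  let M := (rangeSum T).topologicalClosure
  have hM : IsClosed (M : Set X) := (rangeSum T).isClosed_topologicalClosure
  have hx0 : M.mkQL x ≠ 0 := fun h0 => hx ((Submodule.Quotient.mk_eq_zero _).1 h0)
  obtain ⟨v, -, hvx⟩ := exists_dual_vector ℂ (M.mkQL x) (norm_ne_zero_iff.2 hx0)
  refine ⟨v.comp M.mkQL, fun h0 => ?_, fun j => ?_⟩
  · have : v (M.mkQL x) = 0 := DFunLike.congr_fun h0 x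
    rw [this] at hvx
    exact hx0 (norm_eq_zero.1 (RCLike.ofReal_eq_zero.1 hvx.symm))
  · ext y
    have : M.mkQL (T j y) = 0 := (Submodule.Quotient.mk_eq_zero _).2
      ((rangeSum T).le_topologicalClosure (Submodule.mem_iSup_of_mem j ⟨y, rfl⟩))
    simp [this]

theorem exists_dual_norm_comp_le [CompleteSpace X] {T : Fin n → (X →L[ℂ] X)}
    (h : rangeSum T ≠ ⊤) {ε : ℝ} (hε : 0 < ε) :
    ∃ v : X →L[ℂ] ℂ, ‖v‖ = 1 ∧ ∀ j, ‖v.comp (T j)‖ ≤ ε := by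
  rw [← range_rowMap, ne_eq, LinearMap.range_eq_top] at h
  obtain ⟨v, hv, hvT⟩ := exists_dual_norm_comp_le_of_not_surjective (rowMap T) h hε
  refine ⟨v, hv, fun j => ?_⟩
  refine ContinuousLinearMap.opNorm_le_bound _ hε.le fun x => ?_
  have := (v.comp (rowMap T)).le_of_opNorm_le hvT (Pi.single j x)
  rwa [ContinuousLinearMap.comp_apply, rowMap_single, Pi.norm_single] at this

theorem exists_norm_eq_one_half_lt {v : X →L[ℂ] ℂ} (hv : ‖v‖ = 1) :
    ∃ x, ‖x‖ ≤ 1 ∧ 1 / 2 < ‖v x‖ := by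
  by_contra! hcon
  have : ‖v‖ ≤ 1 / 2 :=
    ContinuousLinearMap.opNorm_le_of_unit_norm (𝕜 := ℂ) (by norm_num) fun x hx => hcon x hx.le
  norm_num [hv] at this

end

namespace BanachTensor

variable {X Y Z : Type*} [NormedAddCommGroup X] [NormedSpace ℂ X]
  [NormedAddCommGroup Y] [NormedSpace ℂ Y] [NormedAddCommGroup Z] [NormedSpace ℂ Z]
  {n m : ℕ}

/-- If the range sums of both factors are proper and that of `S` is dense, the tensor tuple is not
lower semi-Fredholm: its range sum would be closed and contain every `x ⊗ y`, but controlled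
preimages of these are incompatible with approximate joint null functionals `u ⊗ v`. -/
theorem not_isLowerSemiFredholm_of_dense [CompleteSpace X] [CompleteSpace Y] [CompleteSpace Z]
    (P : BanachTensor X Y Z) {S : Fin n → (X →L[ℂ] X)} {T : Fin m → (Y →L[ℂ] Y)}
    (hS : rangeSum S ≠ ⊤) (hSd : (rangeSum S).topologicalClosure = ⊤) (hT : rangeSum T ≠ ⊤) :
    ¬ IsLowerSemiFredholm (P.tuple S T) := by
  intro h
  have : Nontrivial Y := by
    by_contra! hY
    exact hT (Subsingleton.elim _ _)
  have hcl := h.isClosed_rangeSum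
  have hmem : ∀ x y, P.vec x y ∈ rangeSum (P.tuple S T) := by
    intro x y
    have hle : rangeSum S ≤ (rangeSum (P.tuple S T)).comap (P.vec.flip y : X →ₗ[ℂ] Z) := by
      refine iSup_le fun i => ?_
      rintro _ ⟨x, rfl⟩
      exact Submodule.mem_iSup_of_mem (Fin.castAdd m i) ⟨P.vec x y, by simp [tuple, P.op_vec]⟩
    have := Submodule.topologicalClosure_minimal _ hle (hcl.preimage (P.vec.flip y).continuous)
    rw [hSd] at this
    exact this Submodule.mem_top
  rw [← range_rowMap] at hcl hmem
  have : CompleteSpace (LinearMap.range (rowMap (P.tuple S T) : (Fin (n + m) → Z) →ₗ[ℂ] Z)) :=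
    hcl.completeSpace_coe
  obtain ⟨C, hC, hpre⟩ := (rowMap (P.tuple S T)).rangeRestrict.exists_preimage_norm_le
    (by rintro ⟨_, x, rfl⟩; exact ⟨x, rfl⟩)
  obtain ⟨c, φ, hc, hφ, hvec, hleft, hright⟩ := P.exists_slice
  -- The contradiction below reads `1 / 4 < (n + m) ε c C`.
  obtain ⟨ε, hε, hεC⟩ : ∃ ε : ℝ, 0 < ε ∧ (n + m) * (ε * (c * C)) ≤ 1 / 4 := by
    have hnm : (0 : ℝ) ≤ n + m := by positivity
    refine ⟨1 / (4 * (n + m + 1) * (c * C + 1)), by positivity, ?_⟩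
    rw [one_div_mul_eq_div, mul_div_assoc', div_le_iff₀ (by positivity)]
    nlinarith [mul_nonneg hc hC.le, mul_nonneg (mul_nonneg hc hC.le) hnm, hnm]
  obtain ⟨u, hu, huS⟩ := exists_dual_norm_comp_le hS hε
  obtain ⟨v, hv, hvT⟩ := exists_dual_norm_comp_le hT hε
  obtain ⟨x, hx, hux⟩ := exists_norm_eq_one_half_lt hu
  obtain ⟨y, hy, hvy⟩ := exists_norm_eq_one_half_lt hv
  obtain ⟨w, hw, hwn⟩ := hpre ⟨P.vec x y, hmem x y⟩
  have hw : rowMap (P.tuple S T) w = P.vec x y := congrArg Subtype.val hw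
  have hwn : ‖w‖ ≤ C := hwn.trans <| by
    rw [Submodule.coe_norm, P.norm_vec]
    exact mul_le_of_le_one_right hC.le (mul_le_one₀ hx (norm_nonneg _) hy)
  have hwi : ∀ i, ‖w i‖ ≤ C := fun i => (norm_le_pi_norm w i).trans hwn
  have key : v y * u x = ∑ i, (u.comp (S i)) (φ v (w (Fin.castAdd m i))) +
      ∑ j, u (φ (v.comp (T j)) (w (Fin.natAdd n j))) := by
    have := congrArg (fun z => u (φ v z)) hw
    simp only [rowMap_apply, Fin.sum_univ_add, tuple, Fin.append_left, Fin.append_right, map_add,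
      map_sum, hleft, hright, hvec, map_smul, smul_eq_mul] at this
    exact this.symm
  have h1 : ∀ i, ‖(u.comp (S i)) (φ v (w (Fin.castAdd m i)))‖ ≤ ε * (c * C) := fun i => by
    refine ((u.comp (S i)).le_of_opNorm_le (huS i) _).trans ?_
    gcongr
    refine (hφ _ _).trans ?_
    rw [hv, mul_one]
    gcongr
    exact hwi _
  have h2 : ∀ j, ‖u (φ (v.comp (T j)) (w (Fin.natAdd n j)))‖ ≤ ε * (c * C) := fun j => by
    refine (u.le_opNorm _).trans ?_
    rw [hu, one_mul]
    refine (hφ _ _).trans ?_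
    calc _ ≤ c * ε * C := by
          gcongr
          exacts [hvT j, hwi _]
      _ = _ := by ring
  have h3 : ‖v y * u x‖ ≤ (n + m) * (ε * (c * C)) := by
    rw [key, add_mul]
    refine (norm_add_le _ _).trans (add_le_add ?_ ?_)
    · exact (norm_sum_le_of_le _ fun i _ => h1 i).trans_eq (by simp)
    · exact (norm_sum_le_of_le _ fun i _ => h2 i).trans_eq (by simp)
  rw [norm_mul] at h3
  nlinarith

theorem isLowerSemiFredholm_left [CompleteSpace X] [CompleteSpace Y] [CompleteSpace Z]
    (P : BanachTensor X Y Z) {S : Fin n → (X →L[ℂ] X)} {T : Fin m → (Y →L[ℂ] Y)}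
    (h : IsLowerSemiFredholm (P.tuple S T)) (hT : rangeSum T ≠ ⊤) : IsLowerSemiFredholm S := by
  by_cases hS : rangeSum S = ⊤
  · rw [IsLowerSemiFredholm, hS]
    infer_instance
  by_cases hTd : (rangeSum T).topologicalClosure = ⊤
  · refine (P.flip.not_isLowerSemiFredholm_of_dense hT hTd hS ?_).elim
    rwa [IsLowerSemiFredholm, rangeSum_flip_tuple]
  · obtain ⟨v, hv, hvT⟩ := exists_dual_comp_eq_zero hTd
    exact P.isLowerSemiFredholm_left_of_dual h hv hvT

theorem isUpperSemiFredholm_flip_tuple [CompleteSpace Z] (P : BanachTensor X Y Z)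
    {S : Fin n → (X →L[ℂ] X)} {T : Fin m → (Y →L[ℂ] Y)} (h : IsUpperSemiFredholm (P.tuple S T)) :
    IsUpperSemiFredholm (P.flip.tuple T S) := by
  rw [flip_tuple]
  exact h.comp_equiv _

theorem forall_tuple_apply_eq_zero (P : BanachTensor X Y Z) {S : Fin n → (X →L[ℂ] X)}
    {T : Fin m → (Y →L[ℂ] Y)} {z : Z} : (∀ k, P.tuple S T k z = 0) ↔
      (∀ i, P.op (S i) (ContinuousLinearMap.id ℂ Y) z = 0) ∧
        ∀ j, P.op (ContinuousLinearMap.id ℂ X) (T j) z = 0 := by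
  refine ⟨fun h => ⟨fun i => ?_, fun j => ?_⟩, fun h k => ?_⟩
  · simpa [tuple] using h (Fin.castAdd m i)
  · simpa [tuple] using h (Fin.natAdd n j)
  · refine Fin.addCases (fun i => ?_) (fun j => ?_) k
    · simpa [tuple] using h.1 i
    · simpa [tuple] using h.2 j

theorem sum_norm_tuple_vec (P : BanachTensor X Y Z) (S : Fin n → (X →L[ℂ] X))
    (T : Fin m → (Y →L[ℂ] Y)) (x : X) (y : Y) :
    ∑ k, ‖P.tuple S T k (P.vec x y)‖ = (∑ i, ‖S i x‖) * ‖y‖ + ‖x‖ * ∑ j, ‖T j y‖ := by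
  simp [Fin.sum_univ_add, tuple, P.op_vec, P.norm_vec, Finset.sum_mul, Finset.mul_sum]

/-- For a joint null vector `y` of `T`, the map `x ↦ x ⊗ y` embeds the column map of `S` into that
of the tensor tuple, and a slice with `v(y) = 1` carries the kernel back. -/
theorem isUpperSemiFredholm_left_of_ker [CompleteSpace X] [CompleteSpace Z]
    (P : BanachTensor X Y Z) {S : Fin n → (X →L[ℂ] X)} {T : Fin m → (Y →L[ℂ] Y)}
    (h : IsUpperSemiFredholm (P.tuple S T)) {y : Y} (hy : ‖y‖ = 1) (hTy : ∀ j, T j y = 0) :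
    IsUpperSemiFredholm S := by
  have hy0 : y ≠ 0 := norm_ne_zero_iff.1 (by rw [hy]; exact one_ne_zero)
  have : Nontrivial Y := ⟨y, 0, hy0⟩
  obtain ⟨c, φ, hc, hφ, hvec, hleft, hright⟩ := P.exists_slice
  obtain ⟨v, hv, hvy⟩ := exists_dual_vector ℂ y (by rw [hy]; exact one_ne_zero)
  have hvy : v y = 1 := by simpa [hy] using hvy
  obtain ⟨hker, hran⟩ := h
  constructor
  · have hmaps : ∀ x ∈ LinearMap.ker (colMap S : X →ₗ[ℂ] (Fin n → X)), P.vec.flip y x ∈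
        LinearMap.ker (colMap (P.tuple S T) : Z →ₗ[ℂ] (Fin (n + m) → Z)) := fun x hx => by
      rw [mem_ker_colMap] at hx ⊢
      rw [forall_tuple_apply_eq_zero]
      simp [P.op_vec, hx, hTy]
    refine FiniteDimensional.of_injective ((P.vec.flip y : X →ₗ[ℂ] Z).restrict hmaps) ?_
    rw [injective_iff_map_eq_zero]
    intro x hx
    have hx : P.vec x y = 0 := congrArg Subtype.val hx
    rw [← norm_eq_zero, P.norm_vec, hy, mul_one] at hx
    exact Subtype.ext (norm_eq_zero.1 hx)
  · rw [isClosed_range_colMap_iff] at hran ⊢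
    obtain ⟨C, hC, hest⟩ := hran
    refine ⟨c * C, by positivity, fun x => ?_⟩
    obtain ⟨w, hw, hxw⟩ := hest (P.vec x y)
    refine ⟨φ v w, fun i => ?_, ?_⟩
    · rw [← hleft, (P.forall_tuple_apply_eq_zero.1 hw).1 i, map_zero]
    · have hx : x - φ v w = φ v (P.vec x y - w) := by rw [map_sub, hvec, hvy, one_smul]
      rw [sum_norm_tuple_vec] at hxw
      rw [hx]
      refine (hφ _ _).trans ?_
      rw [hv, mul_one, mul_assoc]
      gcongr
      simpa [hy, hTy] using hxw

/-- If both column maps have non-closed range and that of `S` is injective, the range of the tensor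
column map is not closed: an element of its kernel close to `x ⊗ y`, for approximate joint null
vectors `x` and `y`, has vanishing slices. -/
theorem not_isClosed_range_colMap_tuple [CompleteSpace X] [CompleteSpace Y] [CompleteSpace Z]
    (P : BanachTensor X Y Z) {S : Fin n → (X →L[ℂ] X)} {T : Fin m → (Y →L[ℂ] Y)}
    (hSk : LinearMap.ker (colMap S : X →ₗ[ℂ] (Fin n → X)) = ⊥)
    (hS : ¬ IsClosed (Set.range (colMap S))) (hT : ¬ IsClosed (Set.range (colMap T))) :
    ¬ IsClosed (Set.range (colMap (P.tuple S T))) := by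
  rw [isClosed_range_colMap_iff]
  rintro ⟨C, hC, hest⟩
  obtain ⟨y', hy', -⟩ := exists_norm_eq_one_sum_le hT one_pos
  have : Nontrivial Y := ⟨y', 0, norm_ne_zero_iff.1 (by rw [hy']; exact one_ne_zero)⟩
  obtain ⟨c, φ, hc, hφ, hvec, hleft, hright⟩ := P.exists_slice
  -- The contradiction below reads `1 ≤ 2 c C ε`.
  obtain ⟨ε, hε, hεC⟩ : ∃ ε : ℝ, 0 < ε ∧ c * (C * (ε + ε)) < 1 := by
    refine ⟨1 / (2 * (c * C + 1)), by positivity, ?_⟩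
    have : c * (C * (1 / (2 * (c * C + 1)) + 1 / (2 * (c * C + 1)))) = c * C / (c * C + 1) := by
      field_simp
      ring
    rw [this, div_lt_one (by positivity)]
    exact lt_add_one _
  obtain ⟨x, hx, hSx⟩ := exists_norm_eq_one_sum_le hS hε
  obtain ⟨y, hy, hTy⟩ := exists_norm_eq_one_sum_le hT hε
  obtain ⟨v, hv, hvy⟩ := exists_dual_vector ℂ y (by rw [hy]; exact one_ne_zero)
  have hvy : v y = 1 := by simpa [hy] using hvy
  obtain ⟨w, hw, hxw⟩ := hest (P.vec x y)
  have hφw : φ v w = 0 := by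
    have : φ v w ∈ LinearMap.ker (colMap S : X →ₗ[ℂ] (Fin n → X)) := mem_ker_colMap.2 fun i => by
      rw [← hleft, (P.forall_tuple_apply_eq_zero.1 hw).1 i, map_zero]
    rwa [hSk] at this
  have hxφ : x = φ v (P.vec x y - w) := by rw [map_sub, hvec, hvy, one_smul, hφw, sub_zero]
  rw [sum_norm_tuple_vec, hx, hy, mul_one, one_mul] at hxw
  have : ‖x‖ ≤ c * (C * (ε + ε)) := by
    rw [hxφ]
    refine (hφ _ _).trans ?_
    rw [hv, mul_one]
    gcongr
    refine hxw.trans ?_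
    gcongr
  rw [hx] at this
  exact absurd this hεC.not_ge

theorem isUpperSemiFredholm_left [CompleteSpace X] [CompleteSpace Y] [CompleteSpace Z]
    (P : BanachTensor X Y Z) {S : Fin n → (X →L[ℂ] X)} {T : Fin m → (Y →L[ℂ] Y)}
    (h : IsUpperSemiFredholm (P.tuple S T))
    (hT : LinearMap.ker (colMap T : Y →ₗ[ℂ] (Fin m → Y)) ≠ ⊥ ∨
      ¬ IsClosed (Set.range (colMap T))) : IsUpperSemiFredholm S := by
  rcases hT with hT | hT
  · obtain ⟨y, hy, hTy⟩ := exists_norm_eq_one_of_ker_ne_bot hT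
    exact P.isUpperSemiFredholm_left_of_ker h hy hTy
  · by_cases hSk : LinearMap.ker (colMap S : X →ₗ[ℂ] (Fin n → X)) = ⊥
    · by_cases hS : IsClosed (Set.range (colMap S))
      · refine ⟨?_, hS⟩
        rw [hSk]
        infer_instance
      · exact (P.not_isClosed_range_colMap_tuple hSk hS hT h.2).elim
    · obtain ⟨x, hx, hSx⟩ := exists_norm_eq_one_of_ker_ne_bot hSk
      exact (hT (P.flip.isUpperSemiFredholm_left_of_ker
        (P.isUpperSemiFredholm_flip_tuple h) hx hSx).2).elim

end BanachTensor

/-! ### Spectra of tensor tuples -/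

theorem append_mem_prodSet {n m : ℕ} {A : Set (Fin n → ℂ)} {B : Set (Fin m → ℂ)}
    {lam : Fin n → ℂ} {mu : Fin m → ℂ} :
    Fin.append lam mu ∈ prodSet A B ↔ lam ∈ A ∧ mu ∈ B := by
  refine ⟨?_, fun h => ⟨lam, h.1, mu, h.2, rfl⟩⟩
  rintro ⟨a, ha, b, hb, hab⟩
  have hl : a = lam := funext fun i => by simpa using congrFun hab (Fin.castAdd m i)
  have hm : b = mu := funext fun j => by simpa using congrFun hab (Fin.natAdd n j)
  exact ⟨hl ▸ ha, hm ▸ hb⟩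

namespace BanachTensor

variable {X Y Z : Type*} [NormedAddCommGroup X] [NormedSpace ℂ X] [CompleteSpace X]
  [NormedAddCommGroup Y] [NormedSpace ℂ Y] [CompleteSpace Y]
  [NormedAddCommGroup Z] [NormedSpace ℂ Z] [CompleteSpace Z] {n m : ℕ}

theorem prodSet_union_subset_sigmaPhiMinus (P : BanachTensor X Y Z) (S : Fin n → (X →L[ℂ] X))
    (T : Fin m → (Y →L[ℂ] Y)) :
    prodSet (sigmaPhiMinus S) (sigmaDelta T) ∪ prodSet (sigmaDelta S) (sigmaPhiMinus T) ⊆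
      sigmaPhiMinus (P.tuple S T) := by
  rintro _ (⟨lam, hS, mu, hT, rfl⟩ | ⟨lam, hS, mu, hT, rfl⟩) h <;> rw [shift_tuple] at h
  · exact hS (P.isLowerSemiFredholm_left h hT)
  · refine hT (P.flip.isLowerSemiFredholm_left (T := shift S lam) ?_ hS)
    rwa [IsLowerSemiFredholm, rangeSum_flip_tuple]

theorem prodSet_union_subset_sigmaPhiPlus (P : BanachTensor X Y Z) (S : Fin n → (X →L[ℂ] X))
    (T : Fin m → (Y →L[ℂ] Y)) :
    prodSet (sigmaPhiPlus S) (sigmaPi T) ∪ prodSet (sigmaPi S) (sigmaPhiPlus T) ⊆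
      sigmaPhiPlus (P.tuple S T) := by
  rintro _ (⟨lam, hS, mu, hT, rfl⟩ | ⟨lam, hS, mu, hT, rfl⟩) h <;> rw [shift_tuple] at h
  · exact hS (P.isUpperSemiFredholm_left h hT)
  · exact hT (P.flip.isUpperSemiFredholm_left (P.isUpperSemiFredholm_flip_tuple h) hS)

/-- A point outside the right-hand side is regular for `S` alone, for `T` alone, or essentially
regular for both. -/
theorem spDeltaE_subset (P : BanachTensor X Y Z) (S : Fin n → (X →L[ℂ] X))
    (T : Fin m → (Y →L[ℂ] Y)) : spDeltaE (P.tuple S T) ⊆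
      prodSet (spDeltaE S) (spDelta T) ∪ prodSet (spDelta S) (spDeltaE T) := by
  intro nu hnu
  obtain ⟨lam, mu, rfl⟩ : ∃ lam mu, nu = Fin.append lam mu :=
    ⟨_, _, Fin.append_castAdd_natAdd.symm⟩
  have hE : spDeltaE (P.tuple S T) ⊆ spDelta (P.tuple S T) :=
    Set.union_subset_union_left _ (sigmaPhiMinus_subset_sigmaDelta _)
  have h1 : lam ∈ spDelta S := by
    by_contra h
    exact P.append_notMem_spDelta_left T mu h (hE hnu)
  have h2 : mu ∈ spDelta T := by
    by_contra h
    exact P.append_notMem_spDelta_right S lam h (hE hnu)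
  rw [Set.mem_union, append_mem_prodSet, append_mem_prodSet]
  by_contra! h
  exact P.append_notMem_spDeltaE (fun hS => h.1 hS h2) (h.2 h1) hnu

theorem spPiE_subset (P : BanachTensor X Y Z) (S : Fin n → (X →L[ℂ] X))
    (T : Fin m → (Y →L[ℂ] Y)) : spPiE (P.tuple S T) ⊆
      prodSet (spPiE S) (spPi T) ∪ prodSet (spPi S) (spPiE T) := by
  intro nu hnu
  obtain ⟨lam, mu, rfl⟩ : ∃ lam mu, nu = Fin.append lam mu :=
    ⟨_, _, Fin.append_castAdd_natAdd.symm⟩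
  have hE : spPiE (P.tuple S T) ⊆ spPi (P.tuple S T) :=
    Set.union_subset_union_left _ (sigmaPhiPlus_subset_sigmaPi _)
  have h1 : lam ∈ spPi S := by
    by_contra h
    exact P.append_notMem_spPi_left T mu h (hE hnu)
  have h2 : mu ∈ spPi T := by
    by_contra h
    exact P.append_notMem_spPi_right S lam h (hE hnu)
  rw [Set.mem_union, append_mem_prodSet, append_mem_prodSet]
  by_contra! h
  exact P.append_notMem_spPiE (fun hS => h.1 hS h2) (h.2 h1) hnu

end BanachTensor

end JointSpectra

theorem proposition4p2
    {X₁ X₂ Z : Type*}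
    [NormedAddCommGroup X₁] [NormedSpace ℂ X₁] [CompleteSpace X₁]
    [NormedAddCommGroup X₂] [NormedSpace ℂ X₂] [CompleteSpace X₂]
    [NormedAddCommGroup Z] [NormedSpace ℂ Z] [CompleteSpace Z]
    (P : BanachTensor X₁ X₂ Z) {n m : ℕ}
    (S : Fin n → (X₁ →L[ℂ] X₁)) (hS : ∀ i j, Commute (S i) (S j))
    (T : Fin m → (X₂ →L[ℂ] X₂)) (hT : ∀ i j, Commute (T i) (T j)) :
    (prodSet (sigmaPhiMinus S) (sigmaDelta T) ∪ prodSet (sigmaDelta S) (sigmaPhiMinus T)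
        ⊆ sigmaPhiMinus (P.tuple S T) ∧
      sigmaPhiMinus (P.tuple S T) ⊆ spDeltaE (P.tuple S T) ∧
      spDeltaE (P.tuple S T)
        ⊆ prodSet (spDeltaE S) (spDelta T) ∪ prodSet (spDelta S) (spDeltaE T)) ∧
    (prodSet (sigmaPhiPlus S) (sigmaPi T) ∪ prodSet (sigmaPi S) (sigmaPhiPlus T)
        ⊆ sigmaPhiPlus (P.tuple S T) ∧
      sigmaPhiPlus (P.tuple S T) ⊆ spPiE (P.tuple S T) ∧
      spPiE (P.tuple S T)
        ⊆ prodSet (spPiE S) (spPi T) ∪ prodSet (spPi S) (spPiE T)) ∧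
    (IsInnerProductNorm X₁ → IsInnerProductNorm X₂ →
      (prodSet (sigmaPhiMinus S) (sigmaDelta T) ∪ prodSet (sigmaDelta S) (sigmaPhiMinus T)
          = sigmaPhiMinus (P.tuple S T) ∧
        sigmaPhiMinus (P.tuple S T) = spDeltaE (P.tuple S T) ∧
        spDeltaE (P.tuple S T)
          = prodSet (spDeltaE S) (spDelta T) ∪ prodSet (spDelta S) (spDeltaE T)) ∧
      (prodSet (sigmaPhiPlus S) (sigmaPi T) ∪ prodSet (sigmaPi S) (sigmaPhiPlus T)
          = sigmaPhiPlus (P.tuple S T) ∧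
        sigmaPhiPlus (P.tuple S T) = spPiE (P.tuple S T) ∧
        spPiE (P.tuple S T)
          = prodSet (spPiE S) (spPi T) ∪ prodSet (spPi S) (spPiE T))) := by
  have hminus := P.prodSet_union_subset_sigmaPhiMinus S T
  have hplus := P.prodSet_union_subset_sigmaPhiPlus S T
  have hminus' := P.spDeltaE_subset S T
  have hplus' := P.spPiE_subset S T
  have hle : sigmaPhiMinus (P.tuple S T) ⊆ spDeltaE (P.tuple S T) := Set.subset_union_left
  have hle' : sigmaPhiPlus (P.tuple S T) ⊆ spPiE (P.tuple S T) := Set.subset_union_left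
  refine ⟨⟨hminus, hle, hminus'⟩, ⟨hplus, hle', hplus'⟩, fun h₁ h₂ => ?_⟩
  -- In Hilbert spaces the outermost sets of both chains coincide.
  rw [spDeltaE_eq h₁, spDelta_eq h₁, spDeltaE_eq h₂, spDelta_eq h₂] at hminus' ⊢
  rw [spPiE_eq h₁, spPi_eq h₁, spPiE_eq h₂, spPi_eq h₂] at hplus' ⊢
  exact ⟨⟨hminus.antisymm (hle.trans hminus'), hle.antisymm (hminus'.trans hminus),
      hminus'.antisymm (hminus.trans hle)⟩,
    ⟨hplus.antisymm (hle'.trans hplus'), hle'.antisymm (hplus'.trans hplus),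
      hplus'.antisymm (hplus.trans hle')⟩⟩
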